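/- Let $M$ be a smooth ($C^\infty$) Banach manifold and $\pi:E\to M$ a smooth Banach vector bundle; all objects are $C^\infty$. For $a,b\in E_m$ let $\xi^V(a,b)=\frac{d}{ds}(a+sb)|_{s=0}\in T_aE$, and let $\nu_\pi$ be its inverse on vertical vectors, $\nu_\pi(\xi^V(a,b))=b$. A section along $\pi$ is a map $\sigma:E\to E$ with $\pi\circ\sigma=\pi$; it is basic if $\sigma=\eta\circ\pi$ for a section $\eta$ of $E$ (and is then identified with $\eta$). Its vertical lift is the vector field $\sigma^V(a)=\xi^V(a,\sigma(a))$ on $E$. Let $\xi^H:\pi^*TM\to TE$ be a (generally nonlinear) Ehresmann connection, that is, a vector bundle map over $E$ with $T\pi(\xi^H(a,v))=v$. For a vector field $X$ on $M$ put $X^H(a)=\xi^H(a,X(\pi(a)))$; put $\kappa(w)=\nu_\pi\big(w-\xi^H(a,T\pi(w))\big)$ for $w\in T_aE$, and $R(X,Y)=\kappa([X^H,Y^H])$. Regard $TE$ as a vector bundle over $TM$, whose operations $+_\tau,\cdot_\tau$ are the differentials of those of $E$; for $T\pi(u)=T\pi(v)$ let $\xi^V_{T\pi}(v,u)=\frac{d}{ds}(v+_\tau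 s\cdot_\tau u)|_{s=0}$, and let $\nu_{T\pi}$ be defined by $\nu_{T\pi}(\xi^V_{T\pi}(v,u))=u$. The linearization of the connection is the linear connection on $\pi^*E\to E$ with horizontal lift $((a,b),w)\mapsto(w,B(a,b)w)$, where $$B(a,b)w=\nu_{T\pi}\Big(\tfrac{d}{ds}\,\xi^H(a+sb,T\pi(w))\Big|_{s=0}\Big)\in T_bE .$$ Its covariant derivative is $D_w\sigma=\nu_\pi\big(T_a\sigma(w)-B(a,\sigma(a))w\big)$ for a section $\sigma$ along $\pi$ and $w\in T_aE$, and its curvature is $\mathrm{Curv}(Y_1,Y_2)\sigma=D_{Y_1}D_{Y_2}\sigma-D_{Y_2}D_{Y_1}\sigma-D_{[Y_1,Y_2]}\sigma$ for vector fields $Y_1,Y_2$ on $E$. A vector field $Y$ on $E$ is called Hor-basic if it is projectable to $M$ and $\kappa(Y)$ is a basic section. **Theorem 6.7.** The Hor-basic vector fields are exactly the fields $Y=X^H+\eta^V$ with $X$ a vector field on $M$ and $\eta$ a section of $E$. For Hor-basic vector fields $Y_i=X_i^H+\eta_i^V$, $i=1,2$, and any section $\sigma$ along $\pi$, $$\mathrm{Curv}(Y_1,Y_2)\sigma=-D_{\sigma^V}\big(R(X_1,X_2)+D_{X_1^H}\eta_2-D_{X_2^H}\eta_1\big).$$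 In particular, for all vector fields $X,Y$ on $M$, sections $\eta,\zeta$ of $E$ and sections $\sigma$ along $\pi$, $$\mathrm{Curv}(X^H,Y^H)\sigma=-D_{\sigma^V}R(X,Y),\qquad \mathrm{Curv}(\eta^V,Y^H)\sigma=D_{\sigma^V}D_{Y^H}\eta,\qquad \mathrm{Curv}(\eta^V,\zeta^V)\sigma=0 .$$ -/

import Mathlib

open scoped Manifold ContDiff
open Bundle

noncomputable section

namespace NonlinearConnection

/-! `M` is a smooth Banach manifold modelled on `B`, and `V` is the family of fibres of a smooth
Banach vector bundle `E = TotalSpace F V` over `M` with model fibre `F`; the bundle projection `π`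
is `TotalSpace.proj`, and a point of `E` over `x` is `⟨x, a⟩` with `a : V x`. -/

section

variable {B : Type*} [NormedAddCommGroup B] [NormedSpace ℝ B]
  {M : Type*} [TopologicalSpace M] [ChartedSpace B M]
  {F : Type*} [NormedAddCommGroup F] [NormedSpace ℝ F]
  {V : M → Type*} [TopologicalSpace (TotalSpace F V)]
  [∀ x, AddCommGroup (V x)] [∀ x, Module ℝ (V x)] [∀ x, TopologicalSpace (V x)]
  [FiberBundle F V] [VectorBundle ℝ F V]

variable (B F) in
/-- The tangent space `T_a E`. -/
abbrev TE (a : TotalSpace F V) : Type _ := TangentSpace (𝓘(ℝ, B).prod 𝓘(ℝ, F)) a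

variable (B) in
/-- The tangent map `T_a π : T_a E → T_{π(a)} M`. -/
def dproj (a : TotalSpace F V) : TE B F a →L[ℝ] TangentSpace 𝓘(ℝ, B) a.proj :=
  mfderiv (𝓘(ℝ, B).prod 𝓘(ℝ, F)) 𝓘(ℝ, B) (TotalSpace.proj : TotalSpace F V → M) a

variable (B) in
/-- The vertical lift `ξ^V(a, b) = d/ds (a + s b)|_{s = 0}`. -/
def vlift (a : TotalSpace F V) (b : V a.proj) : TE B F a :=
  mfderiv 𝓘(ℝ, ℝ) (𝓘(ℝ, B).prod 𝓘(ℝ, F))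
    (fun s : ℝ => (⟨a.proj, a.2 + s • b⟩ : TotalSpace F V)) 0 (1 : ℝ)

/-- The vertical projection at `a`: the inverse of `b ↦ ξ^V(a, b)` on the vertical vectors
(it is used on vertical vectors only). -/
def vproj (a : TotalSpace F V) (w : TE B F a) : V a.proj :=
  Function.invFun (vlift B a) w

/-! ### The structure of `TE` as a vector bundle over `TM`

Its operations `+_τ` and `·_τ` are the differentials of the operations of `E`. -/

/-- The vector tangent to the manifold `E ×_M E` at `(a, b)` that corresponds to the pair
`(v, u) ∈ T_a E × T_b E` with `Tπ v = Tπ u`, that is, whose images under the differentials of the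
two projections `E ×_M E → E` are `v` and `u`. -/
def tangentPair {x : M} {a b : V x} (v : TE B F (⟨x, a⟩ : TotalSpace F V))
    (u : TE B F (⟨x, b⟩ : TotalSpace F V)) :
    TangentSpace (𝓘(ℝ, B).prod 𝓘(ℝ, F × F)) (⟨x, (a, b)⟩ : TotalSpace (F × F) (V ×ᵇ V)) :=
  Classical.epsilon fun p =>
    mfderiv (𝓘(ℝ, B).prod 𝓘(ℝ, F × F)) (𝓘(ℝ, B).prod 𝓘(ℝ, F))
      (fun q : TotalSpace (F × F) (V ×ᵇ V) => (⟨q.proj, q.2.1⟩ : TotalSpace F V))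
      ⟨x, (a, b)⟩ p = v ∧
    mfderiv (𝓘(ℝ, B).prod 𝓘(ℝ, F × F)) (𝓘(ℝ, B).prod 𝓘(ℝ, F))
      (fun q : TotalSpace (F × F) (V ×ᵇ V) => (⟨q.proj, q.2.2⟩ : TotalSpace F V))
      ⟨x, (a, b)⟩ p = u

/-- `v +_τ u`: the differential of the addition `E ×_M E → E`, for `Tπ v = Tπ u`. -/
def addT {x : M} {a b : V x} (v : TE B F (⟨x, a⟩ : TotalSpace F V))
    (u : TE B F (⟨x, b⟩ : TotalSpace F V)) : TE B F (⟨x, a + b⟩ : TotalSpace F V) :=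
  mfderiv (𝓘(ℝ, B).prod 𝓘(ℝ, F × F)) (𝓘(ℝ, B).prod 𝓘(ℝ, F))
    (fun q : TotalSpace (F × F) (V ×ᵇ V) => (⟨q.proj, q.2.1 + q.2.2⟩ : TotalSpace F V))
    ⟨x, (a, b)⟩ (tangentPair v u)

/-- `s ·_τ v`: the differential of the multiplication by `s` on `E`. -/
def smulT {x : M} {a : V x} (s : ℝ) (v : TE B F (⟨x, a⟩ : TotalSpace F V)) :
    TE B F (⟨x, s • a⟩ : TotalSpace F V) :=
  mfderiv (𝓘(ℝ, B).prod 𝓘(ℝ, F)) (𝓘(ℝ, B).prod 𝓘(ℝ, F))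
    (fun e : TotalSpace F V => (⟨e.proj, s • e.2⟩ : TotalSpace F V)) ⟨x, a⟩ v

section

variable [IsManifold 𝓘(ℝ, B) ∞ M] [ContMDiffVectorBundle ∞ F V 𝓘(ℝ, B)]

/-! ### Ehresmann connections and their linearization -/

variable (B F V) in
/-- The bundle projection `π : E → M` as a smooth map. -/
def projMap : C^∞⟮𝓘(ℝ, B).prod 𝓘(ℝ, F), TotalSpace F V; 𝓘(ℝ, B), M⟯ :=
  ⟨TotalSpace.proj, contMDiff_proj V⟩

variable (B F V) in
/-- The bundle `π^*TM` over `E`. -/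
abbrev PullbackTM : TotalSpace F V → Type _ :=
  (projMap B F V) *ᵖ (TangentSpace 𝓘(ℝ, B) : M → Type _)

variable (B F V) in
/-- A (generally nonlinear) connection on `E`: a smooth vector bundle map `ξ^H : π^*TM → TE` over
`E` which is a right inverse of `w ↦ (a, Tπ w)`. -/
structure EhresmannConnection where
  /-- The horizontal lift `v ↦ ξ^H(a, v)`. -/
  lift (a : TotalSpace F V) : TangentSpace 𝓘(ℝ, B) a.proj →L[ℝ] TE B F a
  dproj_lift (a : TotalSpace F V) (v : TangentSpace 𝓘(ℝ, B) a.proj) : dproj B a (lift a v) = v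
  contMDiff_lift :
    ContMDiff ((𝓘(ℝ, B).prod 𝓘(ℝ, F)).prod 𝓘(ℝ, B)) (𝓘(ℝ, B).prod 𝓘(ℝ, F)).tangent ∞
      (fun p : TotalSpace B (PullbackTM B F V) =>
        (⟨p.proj, lift p.proj p.2⟩ :
          TangentBundle (𝓘(ℝ, B).prod 𝓘(ℝ, F)) (TotalSpace F V)))

/-- The vertical lift of `Tπ : TE → TM` at `v ∈ T_a E`:
`ξ^V_{Tπ}(v, u) = d/ds (v +_τ s ·_τ u)|_{s = 0}` for `u ∈ T_b E` with `Tπ u = Tπ v`. -/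
def vliftT {x : M} {a b : V x} (v : TE B F (⟨x, a⟩ : TotalSpace F V))
    (u : TE B F (⟨x, b⟩ : TotalSpace F V)) :
    TangentSpace (𝓘(ℝ, B).prod 𝓘(ℝ, F)).tangent
      (⟨⟨x, a⟩, v⟩ : TangentBundle (𝓘(ℝ, B).prod 𝓘(ℝ, F)) (TotalSpace F V)) :=
  mfderiv 𝓘(ℝ, ℝ) (𝓘(ℝ, B).prod 𝓘(ℝ, F)).tangent
    (fun s : ℝ => (⟨⟨x, a + s • b⟩, addT v (smulT s u)⟩ :
      TangentBundle (𝓘(ℝ, B).prod 𝓘(ℝ, F)) (TotalSpace F V))) 0 (1 : ℝ)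

/-- The vertical projection `ν_{Tπ}`, inverse of the vertical lift: the vector `u` with
`ξ^V_{Tπ}(v, u) = W`, for a `Tπ`-vertical vector `W` tangent to `TE` at `v`. The base point `b` of
`u`, which is determined by `W`, is given as an argument. -/
def vprojT {x : M} {a : V x} (b : V x) (v : TE B F (⟨x, a⟩ : TotalSpace F V))
    (W : TangentSpace (𝓘(ℝ, B).prod 𝓘(ℝ, F)).tangent
      (⟨⟨x, a⟩, v⟩ : TangentBundle (𝓘(ℝ, B).prod 𝓘(ℝ, F)) (TotalSpace F V))) :
    TE B F (⟨x, b⟩ : TotalSpace F V) :=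
  Classical.epsilon fun u =>
    dproj B (⟨x, b⟩ : TotalSpace F V) u = dproj B (⟨x, a⟩ : TotalSpace F V) v ∧ vliftT v u = W

namespace EhresmannConnection

variable (ξ : EhresmannConnection B F V)

/-- The connector `κ : TE → E`: the vertical projection of the vertical part of `w`. -/
def connector (a : TotalSpace F V) (w : TE B F a) : V a.proj :=
  vproj a (w - ξ.lift a (dproj B a w))

/-- The linearization of the connection: the linear map `B(a, b) : T_a E → T_b E`,
`B(a, b) w = ν_{Tπ}(d/ds ξ^H(a + s b, Tπ w)|_{s = 0})`.
The horizontal lift of the linearized connection on `π^*E` is `((a, b), w) ↦ (w, B(a, b) w)`. -/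
def linearization (a : TotalSpace F V) (b : V a.proj) (w : TE B F a) :
    TE B F (⟨a.proj, b⟩ : TotalSpace F V) :=
  vprojT b (ξ.lift a (dproj B a w))
    (mfderiv 𝓘(ℝ, ℝ) (𝓘(ℝ, B).prod 𝓘(ℝ, F)).tangent
      (fun s : ℝ => (⟨⟨a.proj, a.2 + s • b⟩, ξ.lift ⟨a.proj, a.2 + s • b⟩ (dproj B a w)⟩ :
        TangentBundle (𝓘(ℝ, B).prod 𝓘(ℝ, F)) (TotalSpace F V))) 0 (1 : ℝ))

/-- The covariant derivative `D_w σ = ν_π(T_a σ(w) - B(a, σ(a)) w)` of the linearized connection,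
for a section `σ` of `E` along `π` (that is, a section of `π^*E`) and `w ∈ T_a E`. -/
def covDeriv (σ : ∀ a : TotalSpace F V, V a.proj) (a : TotalSpace F V) (w : TE B F a) :
    V a.proj :=
  vproj (⟨a.proj, σ a⟩ : TotalSpace F V)
    (mfderiv (𝓘(ℝ, B).prod 𝓘(ℝ, F)) (𝓘(ℝ, B).prod 𝓘(ℝ, F))
      (fun e : TotalSpace F V => (⟨e.proj, σ e⟩ : TotalSpace F V)) a w -
      ξ.linearization a (σ a) w)

/-- The curvature of the linearized connection:
`Curv(Y₁, Y₂)σ = D_{Y₁} D_{Y₂} σ - D_{Y₂} D_{Y₁} σ - D_{[Y₁, Y₂]} σ`. -/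
def curv (Y₁ Y₂ : ∀ a : TotalSpace F V, TE B F a) (σ : ∀ a : TotalSpace F V, V a.proj)
    (a : TotalSpace F V) : V a.proj :=
  ξ.covDeriv (fun e => ξ.covDeriv σ e (Y₂ e)) a (Y₁ a) -
    ξ.covDeriv (fun e => ξ.covDeriv σ e (Y₁ e)) a (Y₂ a) -
    ξ.covDeriv σ a (VectorField.mlieBracket (𝓘(ℝ, B).prod 𝓘(ℝ, F)) Y₁ Y₂ a)

/-- The horizontal lift `X^H` of a vector field `X` on `M`. -/
def hlift (X : ∀ x : M, TangentSpace 𝓘(ℝ, B) x) (a : TotalSpace F V) : TE B F a :=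
  ξ.lift a (X a.proj)

/-- The curvature `R(X, Y) = κ([X^H, Y^H])` of the nonlinear connection, a section along `π`. -/
def R (X Y : ∀ x : M, TangentSpace 𝓘(ℝ, B) x) (a : TotalSpace F V) : V a.proj :=
  ξ.connector a (VectorField.mlieBracket (𝓘(ℝ, B).prod 𝓘(ℝ, F)) (ξ.hlift X) (ξ.hlift Y) a)

end EhresmannConnection

end

/-! ### Vector fields and sections -/

variable (B) in
/-- The vertical lift `σ^V` of a section `σ` along `π`. -/
def vliftSec (σ : ∀ a : TotalSpace F V, V a.proj) (a : TotalSpace F V) : TE B F a :=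
  vlift B a (σ a)

variable (F) in
/-- The basic section `η ∘ π` along `π` defined by a section `η` of `E`. -/
def basic (η : ∀ x : M, V x) (a : TotalSpace F V) : V a.proj :=
  η a.proj

variable (B F) in
/-- Smoothness of a section `σ` along `π`, as a map `E → E` over `M`. -/
def SmoothAlong (σ : ∀ a : TotalSpace F V, V a.proj) : Prop :=
  ContMDiff (𝓘(ℝ, B).prod 𝓘(ℝ, F)) (𝓘(ℝ, B).prod 𝓘(ℝ, F)) ∞
    (fun a : TotalSpace F V => (⟨a.proj, σ a⟩ : TotalSpace F V))

variable (B F) in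
/-- Smoothness of a section of `E`. -/
def SmoothSection (η : ∀ x : M, V x) : Prop :=
  ContMDiff 𝓘(ℝ, B) (𝓘(ℝ, B).prod 𝓘(ℝ, F)) ∞ (fun x : M => (⟨x, η x⟩ : TotalSpace F V))

section

variable [IsManifold 𝓘(ℝ, B) ∞ M]

/-- Smoothness of a vector field on `M`. -/
def SmoothField (X : ∀ x : M, TangentSpace 𝓘(ℝ, B) x) : Prop :=
  ContMDiff 𝓘(ℝ, B) 𝓘(ℝ, B).tangent ∞ (fun x : M => (⟨x, X x⟩ : TangentBundle 𝓘(ℝ, B) M))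

variable [ContMDiffVectorBundle ∞ F V 𝓘(ℝ, B)]

/-- A smooth vector field `Y` on `E` is `Hor`-basic if it is projectable and `κ(Y)` is basic. -/
def EhresmannConnection.IsHorBasic (ξ : EhresmannConnection B F V)
    (Y : ∀ a : TotalSpace F V, TE B F a) : Prop :=
  ContMDiff (𝓘(ℝ, B).prod 𝓘(ℝ, F)) (𝓘(ℝ, B).prod 𝓘(ℝ, F)).tangent ∞
    (fun a => (⟨a, Y a⟩ : TangentBundle (𝓘(ℝ, B).prod 𝓘(ℝ, F)) (TotalSpace F V))) ∧
  (∃ X : ∀ x : M, TangentSpace 𝓘(ℝ, B) x, SmoothField X ∧ ∀ a, dproj B a (Y a) = X a.proj) ∧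
  ∃ η : ∀ x : M, V x, SmoothSection B F η ∧ ∀ a, ξ.connector a (Y a) = η a.proj

end

end

end NonlinearConnection

end

set_option linter.unusedSectionVars false

noncomputable section

namespace NonlinearConnection

/-! ### Vector fields in charts -/

section Chart

open VectorField Filter
open scoped Topology

variable {E' : Type*} [NormedAddCommGroup E'] [NormedSpace ℝ E']
  {E : Type*} [NormedAddCommGroup E] [NormedSpace ℝ E]
  {H : Type*} [TopologicalSpace H] {I : ModelWithCorners ℝ E H}
  {N : Type*} [TopologicalSpace N] [ChartedSpace H N]

/-! The linearized covariant derivative is a Lie bracket in disguise: for a Hor-basic field `Y = X^H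
+ η^V` and any section `σ` along `π`, `[Y, σ^V] = (D_Y σ)^V` (`mlieBracket_horizontal_vliftSec`). In
bundle coordinates the bracket is the derivative of the fibre coordinate of `σ` along `Y`, minus the
derivative of `Y` in the fibre direction `σ(a)`. The basic part `η` is constant along the fibre, so
only the fibre derivative of the horizontal lift survives, and that is the linearization
(`linearization_spec`, `fibreCoord_covDeriv`).

Two further brackets are needed. Vertical lifts satisfy `[ρ^V, σ^V] = (D_{ρ^V} σ - D_{σ^V} ρ)^V`,
because the connection term vanishes in vertical directions. Hor-basic fields satisfy `[Y₁, Y₂] =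
[X₁, X₂]^H + ρ^V` with `ρ = R(X₁, X₂) + D_{X₁^H} η₂ - D_{X₂^H} η₁`; here `ρ` is in general not
basic.

The Jacobi identity for `Y₁, Y₂, σ^V` now gives the curvature formula. The nested brackets are the
lifts of `D_{Y₁} D_{Y₂} σ` and `D_{Y₂} D_{Y₁} σ`, while `[[Y₁, Y₂], σ^V]` is the lift of `D_{[Y₁,
Y₂]} σ - D_{σ^V} ρ`. The last term is the failure of `ρ` to be basic, and it is the whole curvature.
The special components come from setting some of the `X_i`, `η_i` to zero.

Most of the work is in turning the intrinsic, choice-based definitions of `ν_π`, `+_τ` and `ν_{Tπ}`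
into formulas in coordinates. -/

theorem mfderiv_apply_velocity {f : N → E'} {c : ℝ → N} {n : N} (h : c 0 = n)
    (hf : MDifferentiableAt I 𝓘(ℝ, E') f n) (hc : MDifferentiableAt 𝓘(ℝ, ℝ) I c 0) :
    (mfderiv I 𝓘(ℝ, E') f n : TangentSpace I n → E')
      (mfderiv 𝓘(ℝ, ℝ) I c 0 (1 : ℝ) : TangentSpace I (c 0)) = deriv (f ∘ c) 0 := by
  subst h
  have := mfderiv_comp (0 : ℝ) hf hc
  rw [mfderiv_eq_fderiv] at this
  exact (congrArg (fun L : ℝ →L[ℝ] E' => L 1) this).symm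

variable [IsManifold I ∞ N]

theorem injective_mfderiv_extChartAt {n m : N} (hm : m ∈ (chartAt H n).source) :
    Function.Injective (mfderiv I 𝓘(ℝ, E) (extChartAt I n) m) := by
  exact (isInvertible_mfderiv_extChartAt (by simpa using hm)).injective

theorem surjective_mfderiv_extChartAt {n m : N} (hm : m ∈ (chartAt H n).source) :
    Function.Surjective (mfderiv I 𝓘(ℝ, E) (extChartAt I n) m) := by
  exact (isInvertible_mfderiv_extChartAt (by simpa using hm)).surjective

/-- Smoothness of vector fields is tested in the trivializations of the tangent bundle; this makes
that test one on the differential of a chart. -/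
theorem trivializationAt_tangent_snd {n : N} {p : TangentBundle I N}
    (hp : p.proj ∈ (chartAt H n).source) :
    (trivializationAt E (TangentSpace I) n p).2 = mfderiv I 𝓘(ℝ, E) (extChartAt I n) p.proj p.2 := by
  have h1 := congrArg (fun L : TangentSpace I p.proj →L[ℝ] E => L p.2)
    (TangentBundle.continuousLinearMapAt_trivializationAt (I := I) hp)
  refine Eq.trans ?_ h1
  change _ = (trivializationAt E (TangentSpace I) n).linearMapAt ℝ p.proj p.2
  rw [Trivialization.coe_linearMapAt_of_mem _ (by simpa using hp)]

variable (I) in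
/-- The expression of a vector field in the chart at `n`. -/
def chartRep (n : N) (V : ∀ m : N, TangentSpace I m) (y : E) : E :=
  mfderiv I 𝓘(ℝ, E) (extChartAt I n) ((extChartAt I n).symm y) (V ((extChartAt I n).symm y))

variable [I.Boundaryless]

/-- The differentials of a chart and of its inverse are mutually inverse on the target, so the
inverse differential in the pullback is the differential of the chart. -/
theorem chartRep_eventuallyEq (n : N) (V : ∀ m : N, TangentSpace I m) :
    mpullbackWithin 𝓘(ℝ, E) I (extChartAt I n).symm V (Set.range I)
      =ᶠ[𝓝 (extChartAt I n n)] chartRep I n V := by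
  filter_upwards [extChartAt_target_mem_nhds (I := I) n] with y hy
  have h1 := mfderiv_extChartAt_comp_mfderivWithin_extChartAt_symm hy
  have h2 := mfderivWithin_extChartAt_symm_comp_mfderiv_extChartAt hy
  rw [mpullbackWithin_apply, ContinuousLinearMap.inverse_eq h2 h1]
  rfl

theorem differentiableAt_chartRep [CompleteSpace E] {n : N} {V : ∀ m : N, TangentSpace I m}
    (hV : MDifferentiableAt I I.tangent (fun m => (⟨m, V m⟩ : TangentBundle I N)) n) :
    DifferentiableAt ℝ (chartRep I n V) (extChartAt I n n) := by
  have : IsManifold I 2 N := inferInstance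
  have := (mdifferentiableWithinAt_univ.2 hV).differentiableWithinAt_mpullbackWithin_vectorField
  rw [Set.preimage_univ, Set.univ_inter, I.range_eq_univ] at this
  refine (this.differentiableAt Filter.univ_mem).congr_of_eventuallyEq ?_
  have := chartRep_eventuallyEq (I := I) n V
  rw [I.range_eq_univ] at this
  exact this.symm

/-- The bracket on a manifold is the bracket of the pullbacks to the chart, carried back to the
manifold; it depends only on germs, so the pullbacks may be replaced by `chartRep`. This fixes the
sign: `[V, W] = DW·V - DV·W`. -/
theorem mfderiv_mlieBracket (n : N) (V W : ∀ m : N, TangentSpace I m) :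
    mfderiv I 𝓘(ℝ, E) (extChartAt I n) n (mlieBracket I V W n) =
      fderiv ℝ (chartRep I n W) (extChartAt I n n) (chartRep I n V (extChartAt I n n)) -
      fderiv ℝ (chartRep I n V) (extChartAt I n n) (chartRep I n W (extChartAt I n n)) := by
  have hV := chartRep_eventuallyEq (I := I) n V
  have hW := chartRep_eventuallyEq (I := I) n W
  have hi := isInvertible_mfderiv_extChartAt (mem_extChartAt_source (I := I) n)
  have key : ∀ (f g f' g' : E → E) (s : Set E) (x : E), s = Set.univ → f =ᶠ[𝓝 x] f' →
      g =ᶠ[𝓝 x] g' → lieBracketWithin ℝ f g s x = lieBracket ℝ f' g' x := by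
    intro f g f' g' s x hs hf hg
    rw [hs, lieBracketWithin_univ, hf.lieBracket_vectorField_eq hg]
  rw [← mlieBracketWithin_univ, mlieBracketWithin_apply]
  refine (hi.self_apply_inverse _).trans ?_
  exact key _ _ _ _ _ _ (by rw [Set.preimage_univ, Set.univ_inter, I.range_eq_univ]) hV hW

theorem fderiv_comp_extChartAt_symm {f : N → E'} {n : N} (hf : MDifferentiableAt I 𝓘(ℝ, E') f n)
    (w : TangentSpace I n) :
    fderiv ℝ (f ∘ (extChartAt I n).symm) (extChartAt I n n)
      (mfderiv I 𝓘(ℝ, E) (extChartAt I n) n w) = mfderiv I 𝓘(ℝ, E') f n w := by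
  have h0 : MDifferentiableAt 𝓘(ℝ, E) I (extChartAt I n).symm (extChartAt I n n) := by
    have := mdifferentiableWithinAt_extChartAt_symm (I := I) (mem_extChartAt_target n)
    rwa [I.range_eq_univ, mdifferentiableWithinAt_univ] at this
  have h1 : MDifferentiableAt 𝓘(ℝ, E) 𝓘(ℝ, E') (f ∘ (extChartAt I n).symm) (extChartAt I n n) :=
    MDifferentiableAt.comp _ (by rwa [extChartAt_to_inv n]) h0
  have h2 : MDifferentiableAt I 𝓘(ℝ, E) (extChartAt I n) n :=
    mdifferentiableAt_extChartAt (mem_chart_source H n)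
  have h3 := mfderiv_comp n h1 h2
  have h4 : (f ∘ (extChartAt I n).symm) ∘ extChartAt I n =ᶠ[𝓝 n] f := by
    filter_upwards [extChartAt_source_mem_nhds (I := I) n] with m hm
    simp only [Function.comp_apply, (extChartAt I n).left_inv hm]
  rw [← mfderiv_eq_fderiv, ← h4.mfderiv_eq, h3]
  rfl

end Chart

/-! ### Coordinates on the total space -/

section Coordinates

open Filter
open scoped Topology

variable {B : Type*} [NormedAddCommGroup B] [NormedSpace ℝ B]
  {M : Type*} [TopologicalSpace M] [ChartedSpace B M]
  {F : Type*} [NormedAddCommGroup F] [NormedSpace ℝ F]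
  {V : M → Type*} [TopologicalSpace (TotalSpace F V)]
  [∀ x, AddCommGroup (V x)] [∀ x, Module ℝ (V x)] [∀ x, TopologicalSpace (V x)]
  [FiberBundle F V] [VectorBundle ℝ F V]

variable (F) in
/-- The fibre coordinate over `x` of a vector in the trivialization at `x₀`. -/
def fibreCoord (x₀ : M) {x : M} (a : V x) : F :=
  (trivializationAt F V x₀ ⟨x, a⟩).2

variable (B F V) in
/-- The set of base points at which the bundle coordinates at `x₀` are defined. -/
def coordDom (x₀ : M) : Set M :=
  (trivializationAt F V x₀).baseSet ∩ (chartAt B x₀).source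

variable (B) in
/-- The coordinates on the total space given by the chart and the trivialization at `x₀`. -/
def coord (x₀ : M) (e : TotalSpace F V) : B × F :=
  (extChartAt 𝓘(ℝ, B) x₀ e.proj, (trivializationAt F V x₀ e).2)

variable (B) in
/-- The differential of the coordinates at `x₀`. -/
def dcoord (x₀ : M) (e : TotalSpace F V) : TE B F e →L[ℝ] B × F :=
  mfderiv (𝓘(ℝ, B).prod 𝓘(ℝ, F)) 𝓘(ℝ, B × F) (coord B x₀) e

theorem isOpen_coordDom (x₀ : M) : IsOpen (coordDom B F V x₀) :=
  (trivializationAt F V x₀).open_baseSet.inter (chartAt B x₀).open_source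

theorem mem_coordDom (x₀ : M) : x₀ ∈ coordDom B F V x₀ :=
  ⟨FiberBundle.mem_baseSet_trivializationAt' x₀, mem_chart_source B x₀⟩

theorem eventually_mem_coordDom {x₀ : M} {e : TotalSpace F V} (he : e.proj ∈ coordDom B F V x₀) :
    ∀ᶠ e' : TotalSpace F V in 𝓝 e, e'.proj ∈ coordDom B F V x₀ :=
  (FiberBundle.continuous_proj F V).continuousAt.eventually ((isOpen_coordDom x₀).mem_nhds he)

section fibreCoord

variable {x₀ x : M} (hx : x ∈ coordDom B F V x₀)
include hx

theorem fibreCoord_add (a b : V x) :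
    fibreCoord F x₀ (a + b) = fibreCoord F x₀ a + fibreCoord F x₀ b :=
  ((trivializationAt F V x₀).linear ℝ hx.1).map_add a b

theorem fibreCoord_smul (s : ℝ) (a : V x) :
    fibreCoord F x₀ (s • a) = s • fibreCoord F x₀ a :=
  ((trivializationAt F V x₀).linear ℝ hx.1).map_smul s a

theorem fibreCoord_zero : fibreCoord F x₀ (0 : V x) = 0 := by
  simpa using fibreCoord_smul hx 0 0

theorem fibreCoord_neg (a : V x) : fibreCoord F x₀ (-a) = -fibreCoord F x₀ a := by
  simpa using fibreCoord_smul hx (-1) a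

theorem fibreCoord_sub (a b : V x) :
    fibreCoord F x₀ (a - b) = fibreCoord F x₀ a - fibreCoord F x₀ b := by
  rw [sub_eq_add_neg, fibreCoord_add hx, fibreCoord_neg hx, sub_eq_add_neg]

theorem fibreCoord_bijective : Function.Bijective (fibreCoord F x₀ : V x → F) :=
  ((trivializationAt F V x₀).continuousLinearEquivAt ℝ x hx.1).bijective

end fibreCoord

/-- The chart of `E` at `a` depends only on the base point of `a`, so coordinates indexed by points
of `M` are enough. -/
theorem chartAt_source_totalSpace {a e : TotalSpace F V} :
    e ∈ (chartAt (ModelProd B F) a).source ↔ e.proj ∈ coordDom B F V a.proj := by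
  rw [FiberBundle.chartedSpace_chartAt]
  simp only [OpenPartialHomeomorph.trans_source, OpenPartialHomeomorph.prod_source,
    OpenPartialHomeomorph.refl_source, Set.mem_inter_iff, Set.mem_preimage, Set.mem_prod,
    Set.mem_univ, and_true, coordDom]
  rw [show e ∈ (trivializationAt F V a.proj).toOpenPartialHomeomorph.source ↔ _ from
    Trivialization.mem_source _]
  refine and_congr_right fun h => ?_
  rw [Trivialization.coe_coe, Trivialization.coe_fst' _ h]

theorem extChartAt_eq_coord {a e : TotalSpace F V} (he : e.proj ∈ coordDom B F V a.proj) :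
    extChartAt (𝓘(ℝ, B).prod 𝓘(ℝ, F)) a e = coord B a.proj e := by
  rw [FiberBundle.extChartAt]
  refine Prod.ext ?_ rfl
  change extChartAt 𝓘(ℝ, B) a.proj (trivializationAt F V a.proj e).1 = _
  rw [Trivialization.coe_fst' _ he.1]
  rfl

theorem mfderiv_extChartAt_eq_dcoord {a e : TotalSpace F V}
    (he : e.proj ∈ coordDom B F V a.proj) :
    mfderiv (𝓘(ℝ, B).prod 𝓘(ℝ, F)) 𝓘(ℝ, B × F) (extChartAt (𝓘(ℝ, B).prod 𝓘(ℝ, F)) a) e =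
      dcoord B a.proj e := by
  have : extChartAt (𝓘(ℝ, B).prod 𝓘(ℝ, F)) a =ᶠ[𝓝 e] coord B a.proj :=
    (eventually_mem_coordDom he).mono fun e' he' => extChartAt_eq_coord he'
  exact this.mfderiv_eq

section

variable [IsManifold 𝓘(ℝ, B) ∞ M] [ContMDiffVectorBundle ∞ F V 𝓘(ℝ, B)]

instance : IsManifold (𝓘(ℝ, B).prod 𝓘(ℝ, F)) ∞ (TotalSpace F V) :=
  Bundle.TotalSpace.isManifold F V (IB := 𝓘(ℝ, B))

variable {x₀ : M} {e : TotalSpace F V} (he : e.proj ∈ coordDom B F V x₀)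
include he

theorem mdifferentiableAt_coord :
    MDifferentiableAt (𝓘(ℝ, B).prod 𝓘(ℝ, F)) 𝓘(ℝ, B × F) (coord B x₀) e := by
  -- Any point over `x₀` would serve as centre of the chart; the zero vector is one that always
  -- exists.
  have h : MDifferentiableAt (𝓘(ℝ, B).prod 𝓘(ℝ, F)) 𝓘(ℝ, B × F)
      (extChartAt (𝓘(ℝ, B).prod 𝓘(ℝ, F)) (⟨x₀, 0⟩ : TotalSpace F V)) e :=
    mdifferentiableAt_extChartAt (chartAt_source_totalSpace.2 he)
  exact h.congr_of_eventuallyEq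
    ((eventually_mem_coordDom he).mono fun e' he' =>
      (extChartAt_eq_coord (a := (⟨x₀, 0⟩ : TotalSpace F V)) he').symm)

theorem dcoord_injective : Function.Injective (dcoord B x₀ e) := by
  have := injective_mfderiv_extChartAt (I := 𝓘(ℝ, B).prod 𝓘(ℝ, F))
    (n := (⟨x₀, 0⟩ : TotalSpace F V)) (chartAt_source_totalSpace.2 he)
  rwa [mfderiv_extChartAt_eq_dcoord he] at this

theorem dcoord_surjective : Function.Surjective (dcoord B x₀ e) := by
  have := surjective_mfderiv_extChartAt (I := 𝓘(ℝ, B).prod 𝓘(ℝ, F))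
    (n := (⟨x₀, 0⟩ : TotalSpace F V)) (chartAt_source_totalSpace.2 he)
  rwa [mfderiv_extChartAt_eq_dcoord he] at this

/-- The chain rule for maps into the total space, in coordinates. -/
theorem dcoord_mfderiv {E' : Type*} [NormedAddCommGroup E'] [NormedSpace ℝ E']
    {H : Type*} [TopologicalSpace H] {I : ModelWithCorners ℝ E' H}
    {N : Type*} [TopologicalSpace N] [ChartedSpace H N] {f : N → TotalSpace F V} {n : N}
    (hn : f n = e) (hf : MDifferentiableAt I (𝓘(ℝ, B).prod 𝓘(ℝ, F)) f n) (w : TangentSpace I n) :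
    dcoord B x₀ e (mfderiv I (𝓘(ℝ, B).prod 𝓘(ℝ, F)) f n w : TE B F (f n)) =
      mfderiv I 𝓘(ℝ, B × F) (coord B x₀ ∘ f) n w := by
  subst hn
  rw [mfderiv_comp n (mdifferentiableAt_coord he) hf]
  rfl

/-- The first coordinate of a tangent vector carries exactly its projection to `TM`; verticality is
tested there. -/
theorem dcoord_fst (w : TE B F e) :
    (dcoord B x₀ e w).1 = mfderiv 𝓘(ℝ, B) 𝓘(ℝ, B) (extChartAt 𝓘(ℝ, B) x₀) e.proj
      (dproj B e w) := by
  have h1 : MDifferentiableAt 𝓘(ℝ, B × F) 𝓘(ℝ, B) (Prod.fst : B × F → B) (coord B x₀ e) :=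
    mdifferentiableAt_iff_differentiableAt.2 differentiableAt_fst
  have h2 := mfderiv_comp e h1 (mdifferentiableAt_coord he)
  have h3 := mfderiv_comp e (mdifferentiableAt_extChartAt (I := 𝓘(ℝ, B)) he.2)
    (mdifferentiableAt_proj V (IB := 𝓘(ℝ, B)) (p := e))
  have h4 : mfderiv 𝓘(ℝ, B × F) 𝓘(ℝ, B) (Prod.fst : B × F → B) (coord B x₀ e) =
      ContinuousLinearMap.fst ℝ B F := by
    rw [mfderiv_eq_fderiv]; exact fderiv_fst
  have h5 := congrArg (fun L : TE B F e →L[ℝ] B => L w) h2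
  have h6 := congrArg (fun L : TE B F e →L[ℝ] B => L w) h3
  have h7 := congrArg (fun L : B × F →L[ℝ] B => L (dcoord B x₀ e w)) h4
  exact (h7.symm.trans h5.symm).trans h6

omit he in
theorem contMDiff_fibreLine {x : M} (a b : V x) :
    ContMDiff 𝓘(ℝ, ℝ) (𝓘(ℝ, B).prod 𝓘(ℝ, F)) ∞
      (fun s : ℝ => (⟨x, a + s • b⟩ : TotalSpace F V)) := by
  intro s
  rw [Bundle.contMDiffAt_totalSpace]
  refine ⟨contMDiffAt_const, ?_⟩
  have : (fun s : ℝ => (trivializationAt F V x (⟨x, a + s • b⟩ : TotalSpace F V)).2) =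
      fun s : ℝ => fibreCoord F x a + s • fibreCoord F x b := by
    funext s
    rw [← fibreCoord_smul (mem_coordDom (B := B) x), ← fibreCoord_add (mem_coordDom (B := B) x)]
    rfl
  rw [this, contMDiffAt_iff_contDiffAt]
  fun_prop

omit [IsManifold 𝓘(ℝ, B) ∞ M] [ContMDiffVectorBundle ∞ F V 𝓘(ℝ, B)] in
theorem coord_fibreLine (b : V e.proj) (s : ℝ) :
    coord B x₀ (⟨e.proj, e.2 + s • b⟩ : TotalSpace F V) =
      coord B x₀ e + s • ((0 : B), fibreCoord F x₀ b) := by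
  refine Prod.ext (by simp [coord]) ?_
  change fibreCoord F x₀ (e.2 + s • b) = _
  rw [fibreCoord_add he, fibreCoord_smul he]
  rfl

/-- The coordinates are affine along a line in the fibre, with constant velocity `(0, b)`. -/
theorem dcoord_vlift (b : V e.proj) :
    dcoord B x₀ e (vlift B e b) = ((0 : B), fibreCoord F x₀ b) := by
  have h := mfderiv_apply_velocity (c := fun s : ℝ => (⟨e.proj, e.2 + s • b⟩ : TotalSpace F V))
    (n := e) (by simp) (mdifferentiableAt_coord he)
    ((contMDiff_fibreLine e.2 b).mdifferentiableAt (by simp))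
  refine h.trans ?_
  have : coord B x₀ ∘ (fun s : ℝ => (⟨e.proj, e.2 + s • b⟩ : TotalSpace F V)) =
      fun s => coord B x₀ e + s • ((0 : B), fibreCoord F x₀ b) :=
    funext fun s => coord_fibreLine he b s
  rw [this]
  have h' : deriv (fun s : ℝ => coord B x₀ e + s • ((0 : B), fibreCoord F x₀ b)) 0 =
      ((0 : B), fibreCoord F x₀ b) := by
    simpa using (((hasDerivAt_id (0 : ℝ)).smul_const ((0 : B), fibreCoord F x₀ b)).const_add
      (coord B x₀ e)).deriv
  exact h'

end

end Coordinates

section VerticalBundle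

open Filter
open scoped Topology

variable {B : Type*} [NormedAddCommGroup B] [NormedSpace ℝ B]
  {M : Type*} [TopologicalSpace M] [ChartedSpace B M]
  {F : Type*} [NormedAddCommGroup F] [NormedSpace ℝ F]
  {V : M → Type*} [TopologicalSpace (TotalSpace F V)]
  [∀ x, AddCommGroup (V x)] [∀ x, Module ℝ (V x)] [∀ x, TopologicalSpace (V x)]
  [FiberBundle F V] [VectorBundle ℝ F V]
  [IsManifold 𝓘(ℝ, B) ∞ M] [ContMDiffVectorBundle ∞ F V 𝓘(ℝ, B)]

/-! #### The vertical bundle -/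

theorem dproj_injective_of_fst {e : TotalSpace F V} {v v' : TangentSpace 𝓘(ℝ, B) e.proj}
    (h : mfderiv 𝓘(ℝ, B) 𝓘(ℝ, B) (extChartAt 𝓘(ℝ, B) e.proj) e.proj v =
      mfderiv 𝓘(ℝ, B) 𝓘(ℝ, B) (extChartAt 𝓘(ℝ, B) e.proj) e.proj v') : v = v' :=
  injective_mfderiv_extChartAt (mem_chart_source B e.proj) h

theorem dproj_vlift (a : TotalSpace F V) (b : V a.proj) : dproj B a (vlift B a b) = 0 := by
  refine dproj_injective_of_fst ?_
  rw [← dcoord_fst (mem_coordDom a.proj), dcoord_vlift (mem_coordDom a.proj)]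
  exact (map_zero _).symm

theorem vlift_injective (a : TotalSpace F V) : Function.Injective (vlift B a) := by
  intro b b' h
  have h' := congrArg (dcoord B a.proj a) h
  rw [dcoord_vlift (mem_coordDom a.proj), dcoord_vlift (mem_coordDom a.proj)] at h'
  exact (fibreCoord_bijective (mem_coordDom (B := B) (F := F) (V := V) a.proj)).1
    (Prod.mk.inj h').2

theorem vproj_vlift (a : TotalSpace F V) (b : V a.proj) : vproj a (vlift B a b) = b :=
  Function.leftInverse_invFun (vlift_injective a) b

/-- A vertical vector has first coordinate zero, and its second is attained by some `b` because the
fibre coordinate is onto. With injectivity of the lift this pins down the choice made in `vproj`. -/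
theorem vlift_vproj {a : TotalSpace F V} {w : TE B F a} (hw : dproj B a w = 0) :
    vlift B a (vproj a w) = w := by
  refine Function.invFun_eq ?_
  obtain ⟨b, hb⟩ := (fibreCoord_bijective (mem_coordDom (B := B) (F := F) (V := V) a.proj)).2
    (dcoord B a.proj a w).2
  refine ⟨b, dcoord_injective (mem_coordDom a.proj) ?_⟩
  rw [dcoord_vlift (mem_coordDom a.proj), hb]
  refine Prod.ext ?_ rfl
  rw [dcoord_fst (mem_coordDom a.proj), hw]
  exact (map_zero _).symm

theorem vlift_add (a : TotalSpace F V) (b c : V a.proj) :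
    vlift B a (b + c) = vlift B a b + vlift B a c := by
  refine dcoord_injective (mem_coordDom a.proj) ?_
  rw [map_add, dcoord_vlift (mem_coordDom a.proj), dcoord_vlift (mem_coordDom a.proj),
    dcoord_vlift (mem_coordDom a.proj), fibreCoord_add (mem_coordDom (B := B) a.proj)]
  simp

theorem vlift_zero (a : TotalSpace F V) : vlift B a (0 : V a.proj) = 0 := by
  simpa using vlift_add (B := B) a 0 0

theorem vlift_neg (a : TotalSpace F V) (b : V a.proj) : vlift B a (-b) = -vlift B a b := by
  rw [eq_neg_iff_add_eq_zero, ← vlift_add, neg_add_cancel, vlift_zero]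

theorem vlift_sub (a : TotalSpace F V) (b c : V a.proj) :
    vlift B a (b - c) = vlift B a b - vlift B a c := by
  rw [sub_eq_add_neg, vlift_add, vlift_neg, sub_eq_add_neg]

theorem vproj_zero (a : TotalSpace F V) : vproj a (0 : TE B F a) = 0 := by
  rw [← vlift_zero, vproj_vlift]

/-! #### The operations of `TE` over `TM` in coordinates -/

/-- Vectors at different points of one fibre are compared through their first coordinates, which lie
in the fixed space `B`. -/
theorem dcoord_fst_eq {x : M} {a b : V x} {v : TE B F (⟨x, a⟩ : TotalSpace F V)}
    {u : TE B F (⟨x, b⟩ : TotalSpace F V)}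
    (h : dproj B (⟨x, b⟩ : TotalSpace F V) u = dproj B (⟨x, a⟩ : TotalSpace F V) v) :
    (dcoord B x _ u).1 = (dcoord B x _ v).1 := by
  rw [dcoord_fst (mem_coordDom x), dcoord_fst (mem_coordDom x)]
  exact congrArg (mfderiv 𝓘(ℝ, B) 𝓘(ℝ, B) (extChartAt 𝓘(ℝ, B) x) x) h

theorem dproj_eq_of_dcoord_fst {x : M} {a b : V x} {v : TE B F (⟨x, a⟩ : TotalSpace F V)}
    {u : TE B F (⟨x, b⟩ : TotalSpace F V)} (h : (dcoord B x _ u).1 = (dcoord B x _ v).1) :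
    dproj B (⟨x, b⟩ : TotalSpace F V) u = dproj B (⟨x, a⟩ : TotalSpace F V) v := by
  rw [dcoord_fst (mem_coordDom x), dcoord_fst (mem_coordDom x)] at h
  exact dproj_injective_of_fst (e := (⟨x, b⟩ : TotalSpace F V)) h

theorem coordDom_prod (x : M) : coordDom B (F × F) (V ×ᵇ V) x = coordDom B F V x := by
  change ((trivializationAt F V x).baseSet ∩ (trivializationAt F V x).baseSet) ∩ _ = _
  rw [Set.inter_self]
  rfl

variable (F) in
/-- A fibrewise map `E ×_M E → E` given in the coordinates at `x` by a continuous linear map `L`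
is differentiable over `x`, with differential given by `L` on the fibre component. -/
theorem mdifferentiableAt_fibreProd {f : ∀ x : M, V x → V x → V x} (L : F × F →L[ℝ] F) {x : M}
    (hf : ∀ y ∈ coordDom B F V x, ∀ a b : V y,
      fibreCoord F x (f y a b) = L (fibreCoord F x a, fibreCoord F x b)) (a b : V x) :
    MDifferentiableAt (𝓘(ℝ, B).prod 𝓘(ℝ, F × F)) (𝓘(ℝ, B).prod 𝓘(ℝ, F))
      (fun q : TotalSpace (F × F) (V ×ᵇ V) => (⟨q.proj, f q.proj q.2.1 q.2.2⟩ : TotalSpace F V))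
      ⟨x, (a, b)⟩ ∧
    ∀ p : TE B (F × F) (⟨x, (a, b)⟩ : TotalSpace (F × F) (V ×ᵇ V)),
      dcoord B x (⟨x, f x a b⟩ : TotalSpace F V)
        (mfderiv (𝓘(ℝ, B).prod 𝓘(ℝ, F × F)) (𝓘(ℝ, B).prod 𝓘(ℝ, F))
          (fun q : TotalSpace (F × F) (V ×ᵇ V) =>
            (⟨q.proj, f q.proj q.2.1 q.2.2⟩ : TotalSpace F V)) ⟨x, (a, b)⟩ p) =
      ((dcoord B x _ p).1, L (dcoord B x _ p).2) := by
  set q₀ : TotalSpace (F × F) (V ×ᵇ V) := ⟨x, (a, b)⟩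
  have hq₀ : q₀.proj ∈ coordDom B (F × F) (V ×ᵇ V) x := mem_coordDom x
  have hc : MDifferentiableAt (𝓘(ℝ, B).prod 𝓘(ℝ, F × F)) 𝓘(ℝ, B × (F × F)) (coord B x) q₀ :=
    mdifferentiableAt_coord hq₀
  have hev : ∀ᶠ q : TotalSpace (F × F) (V ×ᵇ V) in 𝓝 q₀,
      fibreCoord F x (f q.proj q.2.1 q.2.2) = L (coord B x q).2 := by
    filter_upwards [eventually_mem_coordDom hq₀] with q hq
    rw [coordDom_prod] at hq
    exact hf _ hq _ _
  have hm : MDifferentiableAt (𝓘(ℝ, B).prod 𝓘(ℝ, F × F)) (𝓘(ℝ, B).prod 𝓘(ℝ, F))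
      (fun q : TotalSpace (F × F) (V ×ᵇ V) =>
        (⟨q.proj, f q.proj q.2.1 q.2.2⟩ : TotalSpace F V)) q₀ := by
    rw [mdifferentiableAt_totalSpace]
    refine ⟨mdifferentiableAt_proj (V ×ᵇ V), ?_⟩
    have h : MDifferentiableAt 𝓘(ℝ, B × (F × F)) 𝓘(ℝ, F) (fun y : B × (F × F) => L y.2)
        (coord B x q₀) := by
      rw [mdifferentiableAt_iff_differentiableAt]; fun_prop
    exact (h.comp q₀ hc).congr_of_eventuallyEq hev
  refine ⟨hm, fun p => ?_⟩
  have hx : (⟨x, f x a b⟩ : TotalSpace F V).proj ∈ coordDom B F V x := mem_coordDom x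
  refine (dcoord_mfderiv hx (n := q₀) rfl hm p).trans ?_
  set Λ : B × (F × F) →L[ℝ] B × F := (ContinuousLinearMap.id ℝ B).prodMap L
  have hΛ : MDifferentiableAt 𝓘(ℝ, B × (F × F)) 𝓘(ℝ, B × F) Λ (coord B x q₀) :=
    mdifferentiableAt_iff_differentiableAt.2 Λ.differentiableAt
  have heq : coord B x ∘ (fun q : TotalSpace (F × F) (V ×ᵇ V) =>
      (⟨q.proj, f q.proj q.2.1 q.2.2⟩ : TotalSpace F V)) =ᶠ[𝓝 q₀] Λ ∘ coord B x :=
    hev.mono fun q hq => Prod.ext rfl hq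
  rw [heq.mfderiv_eq, mfderiv_comp q₀ hΛ hc, mfderiv_eq_fderiv, Λ.fderiv]
  rfl

/-- A vector tangent to `E ×_M E` has one base coordinate and two fibre coordinates, all visible in
its two projections. So the vector chosen by `Classical.epsilon` exists (the base coordinates agree
by `h`) and is determined. -/
theorem tangentPair_spec {x : M} {a b : V x} {v : TE B F (⟨x, a⟩ : TotalSpace F V)}
    {u : TE B F (⟨x, b⟩ : TotalSpace F V)}
    (h : dproj B (⟨x, b⟩ : TotalSpace F V) u = dproj B (⟨x, a⟩ : TotalSpace F V) v) :
    (dcoord B x _ (tangentPair v u)) =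
      ((dcoord B x _ v).1, ((dcoord B x _ v).2, (dcoord B x _ u).2)) := by
  have h1 := (mdifferentiableAt_fibreProd (B := B) F (f := fun (x : M) (a _ : V x) => a)
    (ContinuousLinearMap.fst ℝ F F) (fun _ _ _ _ => rfl) a b).2
  have h2 := (mdifferentiableAt_fibreProd (B := B) F (f := fun (x : M) (_ b : V x) => b)
    (ContinuousLinearMap.snd ℝ F F) (fun _ _ _ _ => rfl) a b).2
  have hx : (⟨x, (a, b)⟩ : TotalSpace (F × F) (V ×ᵇ V)).proj ∈
    coordDom B (F × F) (V ×ᵇ V) x := mem_coordDom x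
  obtain ⟨p, hp⟩ := dcoord_surjective hx ((dcoord B x _ v).1, ((dcoord B x _ v).2, (dcoord B x _ u).2))
  have hex : ∃ p, mfderiv (𝓘(ℝ, B).prod 𝓘(ℝ, F × F)) (𝓘(ℝ, B).prod 𝓘(ℝ, F))
      (fun q : TotalSpace (F × F) (V ×ᵇ V) => (⟨q.proj, q.2.1⟩ : TotalSpace F V))
      ⟨x, (a, b)⟩ p = v ∧
    mfderiv (𝓘(ℝ, B).prod 𝓘(ℝ, F × F)) (𝓘(ℝ, B).prod 𝓘(ℝ, F))
      (fun q : TotalSpace (F × F) (V ×ᵇ V) => (⟨q.proj, q.2.2⟩ : TotalSpace F V))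
      ⟨x, (a, b)⟩ p = u := by
    refine ⟨p, dcoord_injective (x₀ := x) (mem_coordDom x) ?_,
      dcoord_injective (x₀ := x) (mem_coordDom x) ?_⟩
    · refine (h1 p).trans ?_
      rw [hp]
      rfl
    · refine (h2 p).trans ?_
      rw [hp, ← dcoord_fst_eq h]
      rfl
  obtain ⟨e1, e2⟩ := Classical.epsilon_spec hex
  have k1 := (h1 (tangentPair v u)).symm.trans (congrArg (dcoord B x _) e1)
  have k2 := (h2 (tangentPair v u)).symm.trans (congrArg (dcoord B x _) e2)
  have f1 := congrArg Prod.fst k1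
  have f2 := congrArg Prod.snd k1
  have f3 := congrArg Prod.snd k2
  exact Prod.ext f1 (Prod.ext f2 f3)

theorem dcoord_addT {x : M} {a b : V x} {v : TE B F (⟨x, a⟩ : TotalSpace F V)}
    {u : TE B F (⟨x, b⟩ : TotalSpace F V)}
    (h : dproj B (⟨x, b⟩ : TotalSpace F V) u = dproj B (⟨x, a⟩ : TotalSpace F V) v) :
    dcoord B x _ (addT v u) =
      ((dcoord B x _ v).1, (dcoord B x _ v).2 + (dcoord B x _ u).2) := by
  have h1 := (mdifferentiableAt_fibreProd (B := B) F (f := fun (x : M) (a b : V x) => a + b)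
    (ContinuousLinearMap.fst ℝ F F + ContinuousLinearMap.snd ℝ F F)
    (fun _ hy _ _ => fibreCoord_add hy _ _) a b).2 (tangentPair v u)
  refine h1.trans ?_
  rw [tangentPair_spec h]
  rfl

theorem dcoord_smulT {x : M} {a : V x} (s : ℝ) (v : TE B F (⟨x, a⟩ : TotalSpace F V)) :
    dcoord B x _ (smulT s v) = ((dcoord B x _ v).1, s • (dcoord B x _ v).2) := by
  have hx : (⟨x, a⟩ : TotalSpace F V).proj ∈ coordDom B F V x := mem_coordDom x
  have hx' : (⟨x, s • a⟩ : TotalSpace F V).proj ∈ coordDom B F V x := mem_coordDom x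
  have hc := mdifferentiableAt_coord hx
  have hev : ∀ᶠ q : TotalSpace F V in 𝓝 (⟨x, a⟩ : TotalSpace F V),
      fibreCoord F x (s • q.2) = s • (coord B x q).2 := by
    filter_upwards [eventually_mem_coordDom hx] with q hq
    exact fibreCoord_smul hq _ _
  have hm : MDifferentiableAt (𝓘(ℝ, B).prod 𝓘(ℝ, F)) (𝓘(ℝ, B).prod 𝓘(ℝ, F))
      (fun q : TotalSpace F V => (⟨q.proj, s • q.2⟩ : TotalSpace F V)) ⟨x, a⟩ := by
    rw [mdifferentiableAt_totalSpace]
    refine ⟨mdifferentiableAt_proj V, ?_⟩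
    have h : MDifferentiableAt 𝓘(ℝ, B × F) 𝓘(ℝ, F) (fun y : B × F => s • y.2)
        (coord B x ⟨x, a⟩) := by
      rw [mdifferentiableAt_iff_differentiableAt]; fun_prop
    exact (h.comp _ hc).congr_of_eventuallyEq hev
  refine (dcoord_mfderiv hx' (n := (⟨x, a⟩ : TotalSpace F V)) rfl hm v).trans ?_
  set Λ : B × F →L[ℝ] B × F :=
    (ContinuousLinearMap.id ℝ B).prodMap (s • ContinuousLinearMap.id ℝ F)
  have hΛ : MDifferentiableAt 𝓘(ℝ, B × F) 𝓘(ℝ, B × F) Λ (coord B x (⟨x, a⟩ : TotalSpace F V)) :=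
    mdifferentiableAt_iff_differentiableAt.2 Λ.differentiableAt
  have heq : coord B x ∘ (fun q : TotalSpace F V => (⟨q.proj, s • q.2⟩ : TotalSpace F V))
      =ᶠ[𝓝 (⟨x, a⟩ : TotalSpace F V)] Λ ∘ coord B x :=
    hev.mono fun q hq => Prod.ext rfl hq
  rw [heq.mfderiv_eq, mfderiv_comp _ hΛ hc, mfderiv_eq_fderiv, Λ.fderiv]
  rfl

end VerticalBundle

section Linearization

/-! ### Coordinates on `TE` and the linearized connection -/

open Filter
open scoped Topology

variable {B : Type*} [NormedAddCommGroup B] [NormedSpace ℝ B]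
  {M : Type*} [TopologicalSpace M] [ChartedSpace B M]
  {F : Type*} [NormedAddCommGroup F] [NormedSpace ℝ F]
  {V : M → Type*} [TopologicalSpace (TotalSpace F V)]
  [∀ x, AddCommGroup (V x)] [∀ x, Module ℝ (V x)] [∀ x, TopologicalSpace (V x)]
  [FiberBundle F V] [VectorBundle ℝ F V]
  [IsManifold 𝓘(ℝ, B) ∞ M] [ContMDiffVectorBundle ∞ F V 𝓘(ℝ, B)]

variable (B) in
/-- The coordinates on `TE` given by the chart and the trivialization at `x₀`. -/
def coordT (x₀ : M) (p : TangentBundle (𝓘(ℝ, B).prod 𝓘(ℝ, F)) (TotalSpace F V)) :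
    (B × F) × (B × F) :=
  (coord B x₀ p.proj, dcoord B x₀ p.proj p.2)

theorem trivializationAt_tangent_snd_eq_dcoord (a : TotalSpace F V)
    {p : TangentBundle (𝓘(ℝ, B).prod 𝓘(ℝ, F)) (TotalSpace F V)}
    (hp : p.proj.proj ∈ coordDom B F V a.proj) :
    (trivializationAt (B × F) (TangentSpace (𝓘(ℝ, B).prod 𝓘(ℝ, F))) a p).2 =
      dcoord B a.proj p.proj p.2 := by
  rw [trivializationAt_tangent_snd (chartAt_source_totalSpace.2 hp)]
  exact congrArg (fun L : TE B F p.proj →L[ℝ] B × F => L p.2) (mfderiv_extChartAt_eq_dcoord hp)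

/-- Near `p` the chart of `TE` is a map depending only on the point of `M` under `p`, so one map
serves a whole fibre of `TE → M`. -/
theorem extChartAt_tangent_eventuallyEq
    (p : TangentBundle (𝓘(ℝ, B).prod 𝓘(ℝ, F)) (TotalSpace F V)) :
    extChartAt (𝓘(ℝ, B).prod 𝓘(ℝ, F)).tangent p =ᶠ[𝓝 p] coordT B p.proj.proj := by
  have h1 : ∀ᶠ q : TangentBundle (𝓘(ℝ, B).prod 𝓘(ℝ, F)) (TotalSpace F V) in 𝓝 p,
      q.proj.proj ∈ coordDom B F V p.proj.proj :=
    (FiberBundle.continuous_proj (B × F)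
      (TangentSpace (𝓘(ℝ, B).prod 𝓘(ℝ, F)) : TotalSpace F V → Type _)).continuousAt.eventually
      (eventually_mem_coordDom (mem_coordDom p.proj.proj))
  filter_upwards [h1] with q hq
  rw [FiberBundle.extChartAt]
  refine Prod.ext ?_ ?_
  · change extChartAt (𝓘(ℝ, B).prod 𝓘(ℝ, F)) p.proj
      (trivializationAt (B × F) (TangentSpace (𝓘(ℝ, B).prod 𝓘(ℝ, F))) p.proj q).1 = _
    rw [Trivialization.coe_fst', extChartAt_eq_coord hq]
    · rfl
    · exact chartAt_source_totalSpace.2 hq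
  · exact trivializationAt_tangent_snd_eq_dcoord p.proj hq

theorem mdifferentiableAt_coordT (p : TangentBundle (𝓘(ℝ, B).prod 𝓘(ℝ, F)) (TotalSpace F V)) :
    MDifferentiableAt (𝓘(ℝ, B).prod 𝓘(ℝ, F)).tangent 𝓘(ℝ, (B × F) × (B × F))
      (coordT B p.proj.proj) p := by
  have h : MDifferentiableAt (𝓘(ℝ, B).prod 𝓘(ℝ, F)).tangent 𝓘(ℝ, (B × F) × (B × F))
      (extChartAt (𝓘(ℝ, B).prod 𝓘(ℝ, F)).tangent p) p :=
    mdifferentiableAt_extChartAt (mem_chart_source _ p)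
  exact h.congr_of_eventuallyEq (extChartAt_tangent_eventuallyEq p).symm

theorem injective_mfderiv_coordT
    (p : TangentBundle (𝓘(ℝ, B).prod 𝓘(ℝ, F)) (TotalSpace F V)) :
    Function.Injective (mfderiv (𝓘(ℝ, B).prod 𝓘(ℝ, F)).tangent 𝓘(ℝ, (B × F) × (B × F))
      (coordT B p.proj.proj) p) := by
  have := injective_mfderiv_extChartAt (I := (𝓘(ℝ, B).prod 𝓘(ℝ, F)).tangent)
    (mem_chart_source _ p)
  rwa [(extChartAt_tangent_eventuallyEq p).mfderiv_eq] at this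

theorem mdifferentiableAt_curve_tangent {γ : ℝ → TotalSpace F V} {w : ∀ s, TE B F (γ s)}
    (hγ : MDifferentiableAt 𝓘(ℝ, ℝ) (𝓘(ℝ, B).prod 𝓘(ℝ, F)) γ 0) :
    MDifferentiableAt 𝓘(ℝ, ℝ) (𝓘(ℝ, B).prod 𝓘(ℝ, F)).tangent
      (fun s => (⟨γ s, w s⟩ : TangentBundle (𝓘(ℝ, B).prod 𝓘(ℝ, F)) (TotalSpace F V))) 0 ↔
    DifferentiableAt ℝ (fun s => dcoord B (γ 0).proj (γ s) (w s)) 0 := by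
  rw [mdifferentiableAt_totalSpace, ← mdifferentiableAt_iff_differentiableAt]
  refine (and_iff_right hγ).trans (Filter.EventuallyEq.mdifferentiableAt_iff ?_)
  filter_upwards [hγ.continuousAt.eventually (eventually_mem_coordDom
    (mem_coordDom (B := B) (γ 0).proj))] with s hs
  exact trivializationAt_tangent_snd_eq_dcoord (γ 0) (p := ⟨γ s, w s⟩) hs

/-- The point `a + 0 • b` is equal to `a` only propositionally, so the starting point of the curve
enters through the equation `h0`. -/
theorem mfderiv_coordT_curve {x : M} {a b : V x} {v : TE B F (⟨x, a⟩ : TotalSpace F V)}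
    {w : ∀ s : ℝ, TE B F (⟨x, a + s • b⟩ : TotalSpace F V)}
    (h0 : (⟨⟨x, a + (0 : ℝ) • b⟩, w 0⟩ :
      TangentBundle (𝓘(ℝ, B).prod 𝓘(ℝ, F)) (TotalSpace F V)) = ⟨⟨x, a⟩, v⟩)
    {W : B × F} (hw : HasDerivAt (fun s => dcoord B x _ (w s)) W 0) :
    mfderiv (𝓘(ℝ, B).prod 𝓘(ℝ, F)).tangent 𝓘(ℝ, (B × F) × (B × F)) (coordT B x)
      (⟨⟨x, a⟩, v⟩ : TangentBundle (𝓘(ℝ, B).prod 𝓘(ℝ, F)) (TotalSpace F V))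
      (mfderiv 𝓘(ℝ, ℝ) (𝓘(ℝ, B).prod 𝓘(ℝ, F)).tangent
        (fun s : ℝ => (⟨⟨x, a + s • b⟩, w s⟩ :
          TangentBundle (𝓘(ℝ, B).prod 𝓘(ℝ, F)) (TotalSpace F V))) 0 (1 : ℝ) :
        TangentSpace (𝓘(ℝ, B).prod 𝓘(ℝ, F)).tangent _) = (((0 : B), fibreCoord F x b), W) := by
  have hc := (mdifferentiableAt_curve_tangent (w := w) ((contMDiff_fibreLine (B := B) a b).mdifferentiableAt
    (by simp))).2 hw.differentiableAt
  have h2 := mfderiv_apply_velocity h0 (mdifferentiableAt_coordT _) hc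
  refine h2.trans ?_
  have h1 : HasDerivAt (fun s : ℝ => coord B x (⟨x, a + s • b⟩ : TotalSpace F V))
      ((0 : B), fibreCoord F x b) 0 := by
    have hx : (⟨x, a⟩ : TotalSpace F V).proj ∈ coordDom B F V x := mem_coordDom x
    have : (fun s : ℝ => coord B x (⟨x, a + s • b⟩ : TotalSpace F V)) =
        fun s => coord B x (⟨x, a⟩ : TotalSpace F V) + s • ((0 : B), fibreCoord F x b) :=
      funext fun s => coord_fibreLine hx b s
    rw [this]
    simpa using (((hasDerivAt_id (0 : ℝ)).smul_const ((0 : B), fibreCoord F x b)).const_add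
      (coord B x (⟨x, a⟩ : TotalSpace F V)))
  exact (h1.prodMk hw).deriv

theorem tangent_ext {e e' : TotalSpace F V} {w : TE B F e} {w' : TE B F e'} (h : e = e')
    (hx : e'.proj ∈ coordDom B F V e.proj)
    (hw : dcoord B e.proj e w = dcoord B e.proj e' w') :
    (⟨e, w⟩ : TangentBundle (𝓘(ℝ, B).prod 𝓘(ℝ, F)) (TotalSpace F V)) = ⟨e', w'⟩ := by
  subst h
  rw [dcoord_injective hx hw]

/-- In coordinates `v +_τ s ·_τ u` is affine in `s`: the base part stays put and the fibre part
moves with velocity the fibre part of `u`. Hence the vertical lift of `Tπ` determines `u`. -/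
theorem mfderiv_coordT_vliftT {x : M} {a b : V x} {v : TE B F (⟨x, a⟩ : TotalSpace F V)}
    {u : TE B F (⟨x, b⟩ : TotalSpace F V)}
    (h : dproj B (⟨x, b⟩ : TotalSpace F V) u = dproj B (⟨x, a⟩ : TotalSpace F V) v) :
    mfderiv (𝓘(ℝ, B).prod 𝓘(ℝ, F)).tangent 𝓘(ℝ, (B × F) × (B × F)) (coordT B x)
      (⟨⟨x, a⟩, v⟩ : TangentBundle (𝓘(ℝ, B).prod 𝓘(ℝ, F)) (TotalSpace F V)) (vliftT v u) =
      (((0 : B), fibreCoord F x b), ((0 : B), (dcoord B x _ u).2)) := by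
  have key : ∀ s : ℝ, dcoord B x _ (addT v (smulT s u)) =
      dcoord B x _ v + s • ((0 : B), (dcoord B x _ u).2) := by
    intro s
    have h' : dproj B (⟨x, s • b⟩ : TotalSpace F V) (smulT s u) =
        dproj B (⟨x, a⟩ : TotalSpace F V) v := by
      rw [← h]
      exact dproj_eq_of_dcoord_fst (by rw [dcoord_smulT])
    rw [dcoord_addT h', dcoord_smulT]
    refine Prod.ext (by simp) (by simp)
  refine mfderiv_coordT_curve (w := fun s => addT v (smulT s u)) ?_ ?_
  · refine tangent_ext (by simp) (mem_coordDom x) ?_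
    refine (key 0).trans ?_
    simp
  · have : (fun s : ℝ => dcoord B x _ (addT v (smulT s u))) =
      fun s : ℝ => dcoord B x _ v + s • ((0 : B), (dcoord B x _ u).2) := funext key
    rw [this]
    simpa using (((hasDerivAt_id (0 : ℝ)).smul_const ((0 : B), (dcoord B x _ u).2)).const_add
      (dcoord B x _ v))

/-! ### The fibre derivative of the horizontal lift -/

namespace EhresmannConnection

variable (ξ : EhresmannConnection B F V)

/-- The lift of a fixed tangent vector along a line in the fibre is smooth. -/
theorem differentiableAt_lift_fibreLine {x : M} (a b : V x) (v : TangentSpace 𝓘(ℝ, B) x) :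
    DifferentiableAt ℝ (fun s : ℝ => dcoord B x (⟨x, a + s • b⟩ : TotalSpace F V)
      (ξ.lift ⟨x, a + s • b⟩ v)) 0 := by
  have h1 := contMDiff_fibreLine (B := B) (F := F) a b
  have h2 : ContMDiff 𝓘(ℝ, ℝ) ((𝓘(ℝ, B).prod 𝓘(ℝ, F)).prod 𝓘(ℝ, B)) ∞
      (fun s : ℝ => (⟨⟨x, a + s • b⟩, v⟩ : TotalSpace B (PullbackTM B F V))) := by
    intro s
    rw [Bundle.contMDiffAt_totalSpace]
    have h : ContMDiffAt 𝓘(ℝ, ℝ) 𝓘(ℝ, B) ∞ (fun _ : ℝ =>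
        (trivializationAt B (TangentSpace 𝓘(ℝ, B) : M → Type _) x ⟨x, v⟩).2) s :=
      contMDiffAt_const
    exact ⟨h1 s, h⟩
  have h3 := (ξ.contMDiff_lift.comp h2).mdifferentiableAt (x := 0) (by simp)
  exact (mdifferentiableAt_curve_tangent
    (w := fun s : ℝ => ξ.lift (⟨x, a + s • b⟩ : TotalSpace F V) v)
    (h1.mdifferentiableAt (by simp))).1 h3

/-- The derivative of the horizontal lift in the fibre direction, in coordinates. -/
def liftDeriv {x : M} (a b : V x) (v : TangentSpace 𝓘(ℝ, B) x) : B × F :=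
  deriv (fun s : ℝ => dcoord B x (⟨x, a + s • b⟩ : TotalSpace F V)
    (ξ.lift ⟨x, a + s • b⟩ v)) 0

theorem hasDerivAt_lift {x : M} (a b : V x) (v : TangentSpace 𝓘(ℝ, B) x) :
    HasDerivAt (fun s : ℝ => dcoord B x (⟨x, a + s • b⟩ : TotalSpace F V)
      (ξ.lift ⟨x, a + s • b⟩ v)) (ξ.liftDeriv a b v) 0 :=
  (ξ.differentiableAt_lift_fibreLine a b v).hasDerivAt

theorem dcoord_lift_fst {x : M} (a : V x) (v : TangentSpace 𝓘(ℝ, B) x) :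
    (dcoord B x (⟨x, a⟩ : TotalSpace F V) (ξ.lift ⟨x, a⟩ v)).1 =
      mfderiv 𝓘(ℝ, B) 𝓘(ℝ, B) (extChartAt 𝓘(ℝ, B) x) x v := by
  have hx : (⟨x, a⟩ : TotalSpace F V).proj ∈ coordDom B F V x := mem_coordDom x
  rw [dcoord_fst hx, ξ.dproj_lift]

/-- The lift always projects to `v`, so its first coordinate is constant along the fibre. -/
theorem liftDeriv_fst {x : M} (a b : V x) (v : TangentSpace 𝓘(ℝ, B) x) :
    (ξ.liftDeriv a b v).1 = 0 := by
  have h := (ξ.hasDerivAt_lift a b v)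
  have h1 : HasDerivAt (fun s : ℝ => (dcoord B x (⟨x, a + s • b⟩ : TotalSpace F V)
    (ξ.lift ⟨x, a + s • b⟩ v)).1) (ξ.liftDeriv a b v).1 0 :=
      (ContinuousLinearMap.fst ℝ B F).hasFDerivAt.comp_hasDerivAt (0 : ℝ) h
  have h2 : (fun s : ℝ => (dcoord B x (⟨x, a + s • b⟩ : TotalSpace F V)
    (ξ.lift ⟨x, a + s • b⟩ v)).1) = fun _ =>
      (mfderiv 𝓘(ℝ, B) 𝓘(ℝ, B) (extChartAt 𝓘(ℝ, B) x) x v : B) :=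
    funext fun s => ξ.dcoord_lift_fst _ _
  rw [h2] at h1
  exact h1.unique (hasDerivAt_const _ _)

/-- By linearity of the lift in `v`. Applied to the projection of a vertical vector, it removes the
connection term from `D` in vertical directions. -/
theorem liftDeriv_zero_right {x : M} (a b : V x) : ξ.liftDeriv a b 0 = 0 := by
  unfold liftDeriv
  simp only [map_zero]
  exact deriv_const _ _

theorem liftDeriv_zero_left {x : M} (a : V x) (v : TangentSpace 𝓘(ℝ, B) x) :
    ξ.liftDeriv a 0 v = 0 := by
  have h : (fun s : ℝ => dcoord B x (⟨x, a + s • (0 : V x)⟩ : TotalSpace F V)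
      (ξ.lift ⟨x, a + s • (0 : V x)⟩ v)) =
      fun _ => dcoord B x (⟨x, a⟩ : TotalSpace F V) (ξ.lift ⟨x, a⟩ v) := by
    funext s
    have h' : a + s • (0 : V x) = a := by simp
    exact congrArg (fun a' : V x => dcoord B x (⟨x, a'⟩ : TotalSpace F V) (ξ.lift ⟨x, a'⟩ v)) h'
  rw [liftDeriv, h]
  exact deriv_const _ _

/-- The vector with these coordinates solves the equation defining `ν_{Tπ}`, and coordinates of the
vertical lift show that any solution has this fibre coordinate. -/
theorem linearization_spec (a : TotalSpace F V) (b : V a.proj) (w : TE B F a) :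
    dproj B (⟨a.proj, b⟩ : TotalSpace F V) (ξ.linearization a b w) = dproj B a w ∧
    (dcoord B a.proj _ (ξ.linearization a b w)).2 = (ξ.liftDeriv a.2 b (dproj B a w)).2 := by
  obtain ⟨x, a⟩ := a
  change V x at b
  set v : TangentSpace 𝓘(ℝ, B) x := dproj B (⟨x, a⟩ : TotalSpace F V) w
  have hb : (⟨x, b⟩ : TotalSpace F V).proj ∈ coordDom B F V x := mem_coordDom x
  obtain ⟨u, hu⟩ := dcoord_surjective hb
    ((dcoord B x _ w).1, (ξ.liftDeriv a b v).2)
  have hW := mfderiv_coordT_curve (v := ξ.lift (⟨x, a⟩ : TotalSpace F V) v)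
    (w := fun s : ℝ => ξ.lift (⟨x, a + s • b⟩ : TotalSpace F V) v)
    (congrArg (fun a' : V x => (⟨⟨x, a'⟩, ξ.lift (⟨x, a'⟩ : TotalSpace F V) v⟩ :
      TangentBundle (𝓘(ℝ, B).prod 𝓘(ℝ, F)) (TotalSpace F V)))
      (by simp : a + (0 : ℝ) • b = a)) (ξ.hasDerivAt_lift a b v)
  set W : TangentSpace (𝓘(ℝ, B).prod 𝓘(ℝ, F)).tangent
      (⟨⟨x, a⟩, ξ.lift (⟨x, a⟩ : TotalSpace F V) v⟩ :
        TangentBundle (𝓘(ℝ, B).prod 𝓘(ℝ, F)) (TotalSpace F V)) :=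
    mfderiv 𝓘(ℝ, ℝ) (𝓘(ℝ, B).prod 𝓘(ℝ, F)).tangent
      (fun s : ℝ => (⟨⟨x, a + s • b⟩, ξ.lift (⟨x, a + s • b⟩ : TotalSpace F V) v⟩ :
        TangentBundle (𝓘(ℝ, B).prod 𝓘(ℝ, F)) (TotalSpace F V))) 0 (1 : ℝ)
  have hv : dproj B (⟨x, a⟩ : TotalSpace F V) (ξ.lift (⟨x, a⟩ : TotalSpace F V) v) = v :=
    ξ.dproj_lift ⟨x, a⟩ v
  have hu1 : dproj B (⟨x, b⟩ : TotalSpace F V) u = v :=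
    dproj_eq_of_dcoord_fst (v := w) (by rw [hu])
  have hex : ∃ u : TE B F (⟨x, b⟩ : TotalSpace F V),
      dproj B (⟨x, b⟩ : TotalSpace F V) u =
        dproj B (⟨x, a⟩ : TotalSpace F V) (ξ.lift (⟨x, a⟩ : TotalSpace F V) v) ∧
      vliftT (ξ.lift (⟨x, a⟩ : TotalSpace F V) v) u = W := by
    have hu2 : dproj B (⟨x, b⟩ : TotalSpace F V) u =
      dproj B (⟨x, a⟩ : TotalSpace F V) (ξ.lift (⟨x, a⟩ : TotalSpace F V) v) := hu1.trans hv.symm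
    refine ⟨u, hu2, injective_mfderiv_coordT _ ?_⟩
    refine (mfderiv_coordT_vliftT hu2).trans (Eq.trans ?_ hW.symm)
    rw [hu]
    exact Prod.ext rfl (Prod.ext (ξ.liftDeriv_fst a b v).symm rfl)
  obtain ⟨e1, e2⟩ := Classical.epsilon_spec hex
  refine ⟨e1.trans hv, ?_⟩
  have e3 := (mfderiv_coordT_vliftT e1).symm.trans ((congrArg _ e2).trans hW)
  exact (Prod.mk.inj (Prod.mk.inj e3).2).2

end EhresmannConnection

end Linearization

section Brackets

/-! ### Vector fields on the total space -/

open VectorField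

open Filter
open scoped Topology

variable {B : Type*} [NormedAddCommGroup B] [NormedSpace ℝ B]
  {M : Type*} [TopologicalSpace M] [ChartedSpace B M]
  {F : Type*} [NormedAddCommGroup F] [NormedSpace ℝ F]
  {V : M → Type*} [TopologicalSpace (TotalSpace F V)]
  [∀ x, AddCommGroup (V x)] [∀ x, Module ℝ (V x)] [∀ x, TopologicalSpace (V x)]
  [FiberBundle F V] [VectorBundle ℝ F V]
  [IsManifold 𝓘(ℝ, B) ∞ M] [ContMDiffVectorBundle ∞ F V 𝓘(ℝ, B)]

theorem contMDiff_field_iff {Y : ∀ a : TotalSpace F V, TE B F a} :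
    ContMDiff (𝓘(ℝ, B).prod 𝓘(ℝ, F)) (𝓘(ℝ, B).prod 𝓘(ℝ, F)).tangent ∞
      (fun a => (⟨a, Y a⟩ : TangentBundle (𝓘(ℝ, B).prod 𝓘(ℝ, F)) (TotalSpace F V))) ↔
    ∀ a : TotalSpace F V, ContMDiffAt (𝓘(ℝ, B).prod 𝓘(ℝ, F)) 𝓘(ℝ, B × F) ∞
      (fun e => dcoord B a.proj e (Y e)) a := by
  refine forall_congr' fun a => ?_
  rw [Bundle.contMDiffAt_totalSpace]
  refine (and_iff_right contMDiffAt_id).trans (Filter.EventuallyEq.contMDiffAt_iff ?_)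
  filter_upwards [eventually_mem_coordDom (mem_coordDom (B := B) a.proj)] with e he
  exact trivializationAt_tangent_snd_eq_dcoord a (p := ⟨e, Y e⟩) he

/-- Smoothness of a vector field on the total space. -/
def SmoothFieldE (Y : ∀ a : TotalSpace F V, TE B F a) : Prop :=
  ContMDiff (𝓘(ℝ, B).prod 𝓘(ℝ, F)) (𝓘(ℝ, B).prod 𝓘(ℝ, F)).tangent ∞
    (fun a => (⟨a, Y a⟩ : TangentBundle (𝓘(ℝ, B).prod 𝓘(ℝ, F)) (TotalSpace F V)))

theorem SmoothFieldE.mdifferentiableAt {Y : ∀ a : TotalSpace F V, TE B F a} (hY : SmoothFieldE Y)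
    (a : TotalSpace F V) :
    MDifferentiableAt (𝓘(ℝ, B).prod 𝓘(ℝ, F)) (𝓘(ℝ, B).prod 𝓘(ℝ, F)).tangent
      (fun a => (⟨a, Y a⟩ : TangentBundle (𝓘(ℝ, B).prod 𝓘(ℝ, F)) (TotalSpace F V))) a :=
  ContMDiff.mdifferentiableAt hY (by simp)

theorem SmoothFieldE.add {Y Y' : ∀ a : TotalSpace F V, TE B F a} (hY : SmoothFieldE Y)
    (hY' : SmoothFieldE Y') : SmoothFieldE (Y + Y') := by
  refine contMDiff_field_iff.2 fun a => ?_
  have := (contMDiff_field_iff.1 hY a).add (contMDiff_field_iff.1 hY' a)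
  refine this.congr_of_eventuallyEq (Filter.Eventually.of_forall fun e => ?_)
  exact map_add _ _ _

theorem SmoothFieldE.sub {Y Y' : ∀ a : TotalSpace F V, TE B F a} (hY : SmoothFieldE Y)
    (hY' : SmoothFieldE Y') : SmoothFieldE (Y - Y') := by
  refine contMDiff_field_iff.2 fun a => ?_
  have := (contMDiff_field_iff.1 hY a).sub (contMDiff_field_iff.1 hY' a)
  refine this.congr_of_eventuallyEq (Filter.Eventually.of_forall fun e => ?_)
  exact map_sub _ _ _

theorem smoothAlong_iff {σ : ∀ a : TotalSpace F V, V a.proj} :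
    SmoothAlong B F σ ↔ ∀ a : TotalSpace F V, ContMDiffAt (𝓘(ℝ, B).prod 𝓘(ℝ, F)) 𝓘(ℝ, F) ∞
      (fun e => fibreCoord F a.proj (σ e)) a := by
  refine forall_congr' fun a => ?_
  rw [Bundle.contMDiffAt_totalSpace]
  exact and_iff_right (contMDiffAt_proj V)

theorem SmoothAlong.mdifferentiableAt_fibreCoord {σ : ∀ a : TotalSpace F V, V a.proj}
    (hσ : SmoothAlong B F σ) (a : TotalSpace F V) :
    MDifferentiableAt (𝓘(ℝ, B).prod 𝓘(ℝ, F)) 𝓘(ℝ, F)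
      (fun e => fibreCoord F a.proj (σ e)) a :=
  (smoothAlong_iff.1 hσ a).mdifferentiableAt (by simp)

/-- Allows smoothness of `D_Y σ` and `R` to be deduced from that of brackets of vector fields. -/
theorem smoothFieldE_vliftSec_iff {σ : ∀ a : TotalSpace F V, V a.proj} :
    SmoothFieldE (vliftSec B σ) ↔ SmoothAlong B F σ := by
  rw [smoothAlong_iff]
  refine contMDiff_field_iff.trans (forall_congr' fun a => ?_)
  have h : (fun e => dcoord B a.proj e (vliftSec B σ e)) =ᶠ[𝓝 a]
      fun e => ((0 : B), fibreCoord F a.proj (σ e)) := by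
    filter_upwards [eventually_mem_coordDom (mem_coordDom (B := B) a.proj)] with e he
    exact dcoord_vlift he _
  rw [h.contMDiffAt_iff]
  refine ⟨fun h => ?_, fun h => ?_⟩
  · have h2 : ContMDiff 𝓘(ℝ, B × F) 𝓘(ℝ, F) ∞ (Prod.snd : B × F → F) :=
      contMDiff_iff_contDiff.2 contDiff_snd
    exact h2.contMDiffAt.comp a h
  · have h2 : ContMDiff 𝓘(ℝ, F) 𝓘(ℝ, B × F) ∞ (fun y : F => ((0 : B), y)) :=
      contMDiff_iff_contDiff.2 (by fun_prop)
    exact h2.contMDiffAt.comp a h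

theorem SmoothAlong.add {σ τ : ∀ a : TotalSpace F V, V a.proj}
    (hσ : SmoothAlong B F σ) (hτ : SmoothAlong B F τ) : SmoothAlong B F (fun e => σ e + τ e) := by
  rw [← smoothFieldE_vliftSec_iff] at *
  have : vliftSec B (fun e => σ e + τ e) = vliftSec B σ + vliftSec B τ :=
    funext fun e => vlift_add _ _ _
  rw [this]
  exact hσ.add hτ

theorem SmoothAlong.sub {σ τ : ∀ a : TotalSpace F V, V a.proj}
    (hσ : SmoothAlong B F σ) (hτ : SmoothAlong B F τ) : SmoothAlong B F (fun e => σ e - τ e) := by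
  rw [← smoothFieldE_vliftSec_iff] at *
  have : vliftSec B (fun e => σ e - τ e) = vliftSec B σ - vliftSec B τ :=
    funext fun e => vlift_sub _ _ _
  rw [this]
  exact hσ.sub hτ

theorem SmoothSection.basic {η : ∀ x : M, V x} (hη : SmoothSection B F η) :
    SmoothAlong B F (basic F η) :=
  ContMDiff.comp (I' := 𝓘(ℝ, B)) hη (contMDiff_proj V)

theorem EhresmannConnection.smoothFieldE_hlift (ξ : EhresmannConnection B F V)
    {X : ∀ x : M, TangentSpace 𝓘(ℝ, B) x} (hX : SmoothField X) : SmoothFieldE (ξ.hlift X) := by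
  have h : ContMDiff (𝓘(ℝ, B).prod 𝓘(ℝ, F)) ((𝓘(ℝ, B).prod 𝓘(ℝ, F)).prod 𝓘(ℝ, B)) ∞
      (fun a : TotalSpace F V => (⟨a, X a.proj⟩ : TotalSpace B (PullbackTM B F V))) := by
    intro a
    rw [Bundle.contMDiffAt_totalSpace]
    have h1 := (Bundle.contMDiffAt_section a.proj).1 (hX a.proj)
    exact ⟨contMDiffAt_id, h1.comp a (contMDiffAt_proj V)⟩
  exact ξ.contMDiff_lift.comp h

/-! ### Lie brackets on the total space in coordinates -/

theorem chartRep_self (a : TotalSpace F V) (Y : ∀ a : TotalSpace F V, TE B F a) :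
    chartRep (𝓘(ℝ, B).prod 𝓘(ℝ, F)) a Y (extChartAt (𝓘(ℝ, B).prod 𝓘(ℝ, F)) a a) =
      dcoord B a.proj a (Y a) := by
  rw [chartRep, extChartAt_to_inv]
  exact congrArg (fun L : TE B F a →L[ℝ] B × F => L (Y a))
    (mfderiv_extChartAt_eq_dcoord (mem_coordDom a.proj))

theorem chartRep_extChartAt {a e : TotalSpace F V} (he : e.proj ∈ coordDom B F V a.proj)
    (Y : ∀ a : TotalSpace F V, TE B F a) :
    chartRep (𝓘(ℝ, B).prod 𝓘(ℝ, F)) a Y (extChartAt (𝓘(ℝ, B).prod 𝓘(ℝ, F)) a e) =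
      dcoord B a.proj e (Y e) := by
  have h : (extChartAt (𝓘(ℝ, B).prod 𝓘(ℝ, F)) a).symm
      (extChartAt (𝓘(ℝ, B).prod 𝓘(ℝ, F)) a e) = e :=
    (extChartAt (𝓘(ℝ, B).prod 𝓘(ℝ, F)) a).left_inv (by
      rw [extChartAt_source]; exact chartAt_source_totalSpace.2 he)
  rw [chartRep, h]
  exact congrArg (fun L : TE B F e →L[ℝ] B × F => L (Y e))
    (mfderiv_extChartAt_eq_dcoord he)

theorem dcoord_mlieBracket (a : TotalSpace F V) (Y W : ∀ a : TotalSpace F V, TE B F a) :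
    dcoord B a.proj a (mlieBracket (𝓘(ℝ, B).prod 𝓘(ℝ, F)) Y W a) =
      fderiv ℝ (chartRep (𝓘(ℝ, B).prod 𝓘(ℝ, F)) a W)
        (extChartAt (𝓘(ℝ, B).prod 𝓘(ℝ, F)) a a) (dcoord B a.proj a (Y a)) -
      fderiv ℝ (chartRep (𝓘(ℝ, B).prod 𝓘(ℝ, F)) a Y)
        (extChartAt (𝓘(ℝ, B).prod 𝓘(ℝ, F)) a a) (dcoord B a.proj a (W a)) := by
  rw [← chartRep_self a Y, ← chartRep_self a W]
  refine Eq.trans ?_ (mfderiv_mlieBracket a Y W)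
  exact (congrArg (fun L : TE B F a →L[ℝ] B × F => L _)
    (mfderiv_extChartAt_eq_dcoord (mem_coordDom a.proj))).symm

theorem extChartAt_symm_mem_coordDom (a : TotalSpace F V) :
    ∀ᶠ y in 𝓝 (extChartAt (𝓘(ℝ, B).prod 𝓘(ℝ, F)) a a),
      y ∈ (extChartAt (𝓘(ℝ, B).prod 𝓘(ℝ, F)) a).target ∧
      ((extChartAt (𝓘(ℝ, B).prod 𝓘(ℝ, F)) a).symm y).proj ∈ coordDom B F V a.proj := by
  filter_upwards [extChartAt_target_mem_nhds (I := 𝓘(ℝ, B).prod 𝓘(ℝ, F)) a] with y hy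
  refine ⟨hy, chartAt_source_totalSpace.1 ?_⟩
  rw [← extChartAt_source (𝓘(ℝ, B).prod 𝓘(ℝ, F))]
  exact (extChartAt (𝓘(ℝ, B).prod 𝓘(ℝ, F)) a).map_target hy

/-- The derivative of the fibre coordinate of a section along `π`. -/
def fibreDeriv (σ : ∀ a : TotalSpace F V, V a.proj) (a : TotalSpace F V) : TE B F a →L[ℝ] F :=
  mfderiv (𝓘(ℝ, B).prod 𝓘(ℝ, F)) 𝓘(ℝ, F) (fun e => fibreCoord F a.proj (σ e)) a

theorem fderiv_chartRep_vliftSec {σ : ∀ a : TotalSpace F V, V a.proj} (hσ : SmoothAlong B F σ)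
    (a : TotalSpace F V) (w : TE B F a) :
    fderiv ℝ (chartRep (𝓘(ℝ, B).prod 𝓘(ℝ, F)) a (vliftSec B σ))
      (extChartAt (𝓘(ℝ, B).prod 𝓘(ℝ, F)) a a) (dcoord B a.proj a w) =
    ((0 : B), fibreDeriv σ a w) := by
  set f : TotalSpace F V → F := fun e => fibreCoord F a.proj (σ e)
  have hf : MDifferentiableAt (𝓘(ℝ, B).prod 𝓘(ℝ, F)) 𝓘(ℝ, F) f a :=
    hσ.mdifferentiableAt_fibreCoord a
  set L : F →L[ℝ] B × F := ContinuousLinearMap.inr ℝ B F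
  have hL : MDifferentiableAt 𝓘(ℝ, F) 𝓘(ℝ, B × F) L (f a) :=
    mdifferentiableAt_iff_differentiableAt.2 L.differentiableAt
  have h : chartRep (𝓘(ℝ, B).prod 𝓘(ℝ, F)) a (vliftSec B σ)
      =ᶠ[𝓝 (extChartAt (𝓘(ℝ, B).prod 𝓘(ℝ, F)) a a)]
      (L ∘ f) ∘ (extChartAt (𝓘(ℝ, B).prod 𝓘(ℝ, F)) a).symm := by
    filter_upwards [extChartAt_symm_mem_coordDom (B := B) a] with y hy
    have := chartRep_extChartAt hy.2 (vliftSec B σ)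
    rw [(extChartAt (𝓘(ℝ, B).prod 𝓘(ℝ, F)) a).right_inv hy.1] at this
    rw [this]
    exact dcoord_vlift hy.2 _
  have h1 := fderiv_comp_extChartAt_symm (hL.comp a hf) w
  have h2 := congrArg (fun L : TE B F a →L[ℝ] B × F => L w)
    (mfderiv_extChartAt_eq_dcoord (mem_coordDom a.proj))
  have h3 := mfderiv_comp a hL hf
  rw [mfderiv_eq_fderiv, L.fderiv] at h3
  rw [h.fderiv_eq]
  refine Eq.trans (congrArg (fderiv ℝ _ _) h2.symm) (h1.trans ?_)
  exact congrArg (fun A : TE B F a →L[ℝ] B × F => A w) h3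

/-- A fibre line is a straight line in the chart, so a vertical derivative can be taken along it;
this is how `liftDeriv` enters the bracket. -/
theorem fderiv_chartRep_vertical [CompleteSpace B] [CompleteSpace F]
    {Y : ∀ a : TotalSpace F V, TE B F a} (hY : SmoothFieldE Y) (a : TotalSpace F V)
    (b : V a.proj) {W : B × F}
    (hW : HasDerivAt (fun s : ℝ => dcoord B a.proj (⟨a.proj, a.2 + s • b⟩ : TotalSpace F V)
      (Y ⟨a.proj, a.2 + s • b⟩)) W 0) :
    fderiv ℝ (chartRep (𝓘(ℝ, B).prod 𝓘(ℝ, F)) a Y)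
      (extChartAt (𝓘(ℝ, B).prod 𝓘(ℝ, F)) a a) (dcoord B a.proj a (vlift B a b)) = W := by
  have ha : a.proj ∈ coordDom B F V a.proj := mem_coordDom a.proj
  have h := (differentiableAt_chartRep (hY.mdifferentiableAt a)).hasFDerivAt
  have hl : HasDerivAt (fun s : ℝ => extChartAt (𝓘(ℝ, B).prod 𝓘(ℝ, F)) a a +
      s • ((0 : B), fibreCoord F a.proj b)) ((0 : B), fibreCoord F a.proj b) 0 := by
    simpa using (((hasDerivAt_id (0 : ℝ)).smul_const ((0 : B), fibreCoord F a.proj b)).const_add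
      (extChartAt (𝓘(ℝ, B).prod 𝓘(ℝ, F)) a a : B × F))
  have h' := HasFDerivAt.comp_hasDerivAt_of_eq (0 : ℝ) h hl (by simp)
  have he : (chartRep (𝓘(ℝ, B).prod 𝓘(ℝ, F)) a Y ∘
      fun s : ℝ => extChartAt (𝓘(ℝ, B).prod 𝓘(ℝ, F)) a a +
        s • ((0 : B), fibreCoord F a.proj b)) =
      fun s : ℝ => dcoord B a.proj (⟨a.proj, a.2 + s • b⟩ : TotalSpace F V)
        (Y ⟨a.proj, a.2 + s • b⟩) := by
    funext s
    have hs : (⟨a.proj, a.2 + s • b⟩ : TotalSpace F V).proj ∈ coordDom B F V a.proj := ha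
    rw [← chartRep_extChartAt hs, extChartAt_eq_coord hs, coord_fibreLine ha,
      ← extChartAt_eq_coord ha]
    rfl
  rw [he] at h'
  rw [dcoord_vlift ha]
  exact h'.unique hW

/-- The bracket of projectable vector fields is projectable. -/
theorem dproj_mlieBracket [CompleteSpace B] [CompleteSpace F]
    {Y₁ Y₂ : ∀ a : TotalSpace F V, TE B F a} (hY₁ : SmoothFieldE Y₁) (hY₂ : SmoothFieldE Y₂)
    {X₁ X₂ : ∀ x : M, TangentSpace 𝓘(ℝ, B) x} (hX₁ : SmoothField X₁) (hX₂ : SmoothField X₂)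
    (h₁ : ∀ a, dproj B a (Y₁ a) = X₁ a.proj) (h₂ : ∀ a, dproj B a (Y₂ a) = X₂ a.proj)
    (a : TotalSpace F V) :
    dproj B a (mlieBracket (𝓘(ℝ, B).prod 𝓘(ℝ, F)) Y₁ Y₂ a) =
      mlieBracket 𝓘(ℝ, B) X₁ X₂ a.proj := by
  have ha : a.proj ∈ coordDom B F V a.proj := mem_coordDom a.proj
  have hfst : (extChartAt (𝓘(ℝ, B).prod 𝓘(ℝ, F)) a a).1 = extChartAt 𝓘(ℝ, B) a.proj a.proj := by
    rw [extChartAt_eq_coord ha]; rfl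
  -- The first component of `Y` in the chart is the representative of `X` composed with the
  -- projection `B × F → B`; differentiating gives the claim.
  have key : ∀ (Y : ∀ a : TotalSpace F V, TE B F a) (X : ∀ x : M, TangentSpace 𝓘(ℝ, B) x),
      SmoothFieldE Y → SmoothField X → (∀ a, dproj B a (Y a) = X a.proj) → ∀ w : B × F,
      (fderiv ℝ (chartRep (𝓘(ℝ, B).prod 𝓘(ℝ, F)) a Y)
        (extChartAt (𝓘(ℝ, B).prod 𝓘(ℝ, F)) a a) w).1 =
      fderiv ℝ (chartRep 𝓘(ℝ, B) a.proj X) (extChartAt 𝓘(ℝ, B) a.proj a.proj) w.1 := by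
    intro Y X hY hX h w
    have hYd := (differentiableAt_chartRep (hY.mdifferentiableAt a)).hasFDerivAt
    have hXd := (differentiableAt_chartRep
      (ContMDiff.mdifferentiableAt hX (x := a.proj) (by simp))).hasFDerivAt
    have e1 := (ContinuousLinearMap.fst ℝ B F).hasFDerivAt.comp _ hYd
    have hXd' : HasFDerivAt (chartRep 𝓘(ℝ, B) a.proj X)
        (fderiv ℝ (chartRep 𝓘(ℝ, B) a.proj X) (extChartAt 𝓘(ℝ, B) a.proj a.proj))
        (ContinuousLinearMap.fst ℝ B F (extChartAt (𝓘(ℝ, B).prod 𝓘(ℝ, F)) a a)) := by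
      rw [show ContinuousLinearMap.fst ℝ B F (extChartAt (𝓘(ℝ, B).prod 𝓘(ℝ, F)) a a) =
        extChartAt 𝓘(ℝ, B) a.proj a.proj from hfst]
      exact hXd
    have e2 := hXd'.comp _ (ContinuousLinearMap.fst ℝ B F).hasFDerivAt
    have heq : ContinuousLinearMap.fst ℝ B F ∘ chartRep (𝓘(ℝ, B).prod 𝓘(ℝ, F)) a Y
        =ᶠ[𝓝 (extChartAt (𝓘(ℝ, B).prod 𝓘(ℝ, F)) a a)]
        chartRep 𝓘(ℝ, B) a.proj X ∘ ContinuousLinearMap.fst ℝ B F := by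
      filter_upwards [extChartAt_symm_mem_coordDom (B := B) a] with y hy
      set e := (extChartAt (𝓘(ℝ, B).prod 𝓘(ℝ, F)) a).symm y
      have hy' : extChartAt (𝓘(ℝ, B).prod 𝓘(ℝ, F)) a e = y :=
        (extChartAt (𝓘(ℝ, B).prod 𝓘(ℝ, F)) a).right_inv hy.1
      have he : e.proj = (extChartAt 𝓘(ℝ, B) a.proj).symm y.1 := by
        rw [← hy', extChartAt_eq_coord hy.2]
        exact ((extChartAt 𝓘(ℝ, B) a.proj).left_inv
          (by rw [extChartAt_source]; exact hy.2.2)).symm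
      rw [← hy', Function.comp_apply, chartRep_extChartAt hy.2, hy']
      refine (dcoord_fst hy.2 _).trans ?_
      rw [h]
      change _ = chartRep 𝓘(ℝ, B) a.proj X y.1
      rw [chartRep, ← he]
    have e3 := (e1.congr_of_eventuallyEq heq.symm).unique e2
    exact congrArg (fun L : B × F →L[ℝ] B => L w) e3
  refine dproj_injective_of_fst ?_
  rw [← dcoord_fst ha, dcoord_mlieBracket, mfderiv_mlieBracket]
  have hs : ∀ X : ∀ x : M, TangentSpace 𝓘(ℝ, B) x,
      chartRep 𝓘(ℝ, B) a.proj X (extChartAt 𝓘(ℝ, B) a.proj a.proj) =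
        mfderiv 𝓘(ℝ, B) 𝓘(ℝ, B) (extChartAt 𝓘(ℝ, B) a.proj) a.proj (X a.proj) := by
    intro X
    rw [chartRep, extChartAt_to_inv]
  have k1 := key Y₂ X₂ hY₂ hX₂ h₂ (dcoord B a.proj a (Y₁ a))
  have k2 := key Y₁ X₁ hY₁ hX₁ h₁ (dcoord B a.proj a (Y₂ a))
  rw [dcoord_fst ha, h₁] at k1
  rw [dcoord_fst ha, h₂] at k2
  rw [hs, hs]
  exact congrArg₂ (fun p q : B => p - q) k1 k2

end Brackets

section Curvature

/-! ### The covariant derivative as a bracket, and the curvature -/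

open VectorField

open Filter
open scoped Topology

variable {B : Type*} [NormedAddCommGroup B] [NormedSpace ℝ B]
  {M : Type*} [TopologicalSpace M] [ChartedSpace B M]
  {F : Type*} [NormedAddCommGroup F] [NormedSpace ℝ F]
  {V : M → Type*} [TopologicalSpace (TotalSpace F V)]
  [∀ x, AddCommGroup (V x)] [∀ x, Module ℝ (V x)] [∀ x, TopologicalSpace (V x)]
  [FiberBundle F V] [VectorBundle ℝ F V]
  [IsManifold 𝓘(ℝ, B) ∞ M] [ContMDiffVectorBundle ∞ F V 𝓘(ℝ, B)]

namespace EhresmannConnection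

variable (ξ : EhresmannConnection B F V)

/-- `T_a σ(w)` and `B(a, σ(a)) w` project to the same vector, so their difference is vertical and
`ν_π` reads off its second coordinate. -/
theorem fibreCoord_covDeriv {σ : ∀ a : TotalSpace F V, V a.proj} (hσ : SmoothAlong B F σ)
    (a : TotalSpace F V) (w : TE B F a) :
    fibreCoord F a.proj (ξ.covDeriv σ a w) =
      fibreDeriv σ a w -
      (ξ.liftDeriv a.2 (σ a) (dproj B a w)).2 := by
  set b : TotalSpace F V := ⟨a.proj, σ a⟩
  have ha : b.proj ∈ coordDom B F V a.proj := mem_coordDom a.proj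
  set S : TE B F b := mfderiv (𝓘(ℝ, B).prod 𝓘(ℝ, F)) (𝓘(ℝ, B).prod 𝓘(ℝ, F))
      (fun e : TotalSpace F V => (⟨e.proj, σ e⟩ : TotalSpace F V)) a w
  have hm : MDifferentiableAt (𝓘(ℝ, B).prod 𝓘(ℝ, F)) (𝓘(ℝ, B).prod 𝓘(ℝ, F))
      (fun e : TotalSpace F V => (⟨e.proj, σ e⟩ : TotalSpace F V)) a :=
    ContMDiff.mdifferentiableAt hσ (by simp)
  have h1 : dproj B b S = dproj B a w := by
    have := mfderiv_comp a (mdifferentiableAt_proj V (IB := 𝓘(ℝ, B)) (p := b)) hm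
    exact (congrArg (fun L : TE B F a →L[ℝ] B => L w) this).symm
  have hl := ξ.linearization_spec a (σ a) w
  have hv : dproj B b (S - ξ.linearization a (σ a) w) = 0 := by
    rw [map_sub, h1]
    exact sub_eq_zero.2 hl.1.symm
  have h2 := congrArg (dcoord B a.proj b) (vlift_vproj hv)
  rw [dcoord_vlift ha, map_sub] at h2
  have h3 := congrArg Prod.snd h2
  refine h3.trans ?_
  refine (Prod.snd_sub _ _).trans (congrArg₂ (fun p q : F => p - q) ?_ hl.2)
  have h4 := dcoord_mfderiv ha (n := a) rfl hm w
  have h5 : MDifferentiableAt 𝓘(ℝ, B × F) 𝓘(ℝ, F) (ContinuousLinearMap.snd ℝ B F)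
      (coord B a.proj b) :=
    mdifferentiableAt_iff_differentiableAt.2 (ContinuousLinearMap.snd ℝ B F).differentiableAt
  have h6 := mfderiv_comp a h5 ((mdifferentiableAt_coord ha).comp a hm)
  rw [mfderiv_eq_fderiv, ContinuousLinearMap.fderiv] at h6
  have h7 := congrArg (fun L : TE B F a →L[ℝ] F => L w) h6
  exact (congrArg Prod.snd h4).trans h7.symm

/-- The connection term sees only the projection of `w`, which a vertical vector does not change. -/
theorem covDeriv_add_vlift {σ : ∀ a : TotalSpace F V, V a.proj} (hσ : SmoothAlong B F σ)
    (a : TotalSpace F V) (w : TE B F a) (b : V a.proj) :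
    ξ.covDeriv σ a (w + vlift B a b) = ξ.covDeriv σ a w + ξ.covDeriv σ a (vlift B a b) := by
  refine (fibreCoord_bijective (F := F) (mem_coordDom (B := B) a.proj)).1 ?_
  rw [fibreCoord_add (mem_coordDom (B := B) a.proj), ξ.fibreCoord_covDeriv hσ,
    ξ.fibreCoord_covDeriv hσ, ξ.fibreCoord_covDeriv hσ, map_add, map_add, dproj_vlift, add_zero,
    liftDeriv_zero_right, Prod.snd_zero]
  abel

/-- A basic section is constant along fibres, and vertical directions carry no connection term. -/
theorem covDeriv_basic_vlift {η : ∀ x : M, V x} (hη : SmoothSection B F η)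
    (a : TotalSpace F V) (b : V a.proj) :
    ξ.covDeriv (basic F η) a (vlift B a b) = 0 := by
  refine (fibreCoord_bijective (F := F) (mem_coordDom (B := B) a.proj)).1 ?_
  rw [ξ.fibreCoord_covDeriv hη.basic, dproj_vlift, liftDeriv_zero_right,
    fibreCoord_zero (mem_coordDom (B := B) a.proj)]
  have h := mfderiv_apply_velocity (c := fun s : ℝ => (⟨a.proj, a.2 + s • b⟩ : TotalSpace F V))
    (n := a) (by simp) (hη.basic.mdifferentiableAt_fibreCoord a)
    ((contMDiff_fibreLine (B := B) a.2 b).mdifferentiableAt (by simp))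
  have h' : deriv ((fun e : TotalSpace F V => fibreCoord F a.proj (basic F η e)) ∘
    fun s : ℝ => (⟨a.proj, a.2 + s • b⟩ : TotalSpace F V)) 0 = 0 :=
    deriv_const (0 : ℝ) (fibreCoord F a.proj (η a.proj))
  have h'' : fibreDeriv (basic F η) a (vlift B a b) = 0 :=
    h.trans h'
  exact (congrArg (fun p : F => p - 0) h'').trans (sub_zero 0)

theorem covDeriv_neg {σ : ∀ a : TotalSpace F V, V a.proj} (hσ : SmoothAlong B F σ)
    (a : TotalSpace F V) (b : V a.proj) :
    ξ.covDeriv (fun e => -σ e) a (vlift B a b) = -ξ.covDeriv σ a (vlift B a b) := by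
  have h0 : SmoothAlong B F (fun e => -σ e) := by
    -- Here `-σ` is written as `(σ - σ) - σ`.
    simpa using (hσ.sub hσ).sub hσ
  refine (fibreCoord_bijective (F := F) (mem_coordDom (B := B) a.proj)).1 ?_
  rw [fibreCoord_neg (mem_coordDom (B := B) a.proj), ξ.fibreCoord_covDeriv hσ,
    ξ.fibreCoord_covDeriv h0, dproj_vlift, liftDeriv_zero_right, liftDeriv_zero_right]
  have h1 : (fun e : TotalSpace F V => fibreCoord F a.proj (-σ e)) =ᶠ[𝓝 a]
      -fun e : TotalSpace F V => fibreCoord F a.proj (σ e) := by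
    filter_upwards [eventually_mem_coordDom (mem_coordDom (B := B) a.proj)] with e he
    exact fibreCoord_neg he _
  rw [fibreDeriv, h1.mfderiv_eq, mfderiv_neg]
  exact (sub_zero _).trans (congrArg Neg.neg (sub_zero _).symm)

theorem covDeriv_zero (a : TotalSpace F V) (w : TE B F a) :
    ξ.covDeriv (fun e => (0 : V e.proj)) a w = 0 := by
  have h0 : SmoothAlong B F (fun e : TotalSpace F V => (0 : V e.proj)) :=
    SmoothSection.basic (contMDiff_zeroSection ℝ V)
  refine (fibreCoord_bijective (F := F) (mem_coordDom (B := B) a.proj)).1 ?_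
  rw [ξ.fibreCoord_covDeriv h0, liftDeriv_zero_left,
    fibreCoord_zero (mem_coordDom (B := B) a.proj)]
  have h1 : (fun e : TotalSpace F V => fibreCoord F a.proj (0 : V e.proj)) =ᶠ[𝓝 a]
      fun _ => 0 := by
    filter_upwards [eventually_mem_coordDom (mem_coordDom (B := B) a.proj)] with e he
    exact fibreCoord_zero he
  rw [fibreDeriv, h1.mfderiv_eq, mfderiv_const]
  exact sub_zero (0 : F)

/-! ### Brackets with vertical lifts and the curvature -/

section Complete

variable [CompleteSpace B] [CompleteSpace F]

/-- The key identity: the bracket and the local formula for `D` consist of the same two terms, the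
derivative of `σ` along `Y` and the fibre derivative of the lift in the direction `σ(a)`. -/
theorem mlieBracket_horizontal_vliftSec {X : ∀ x : M, TangentSpace 𝓘(ℝ, B) x} {η : ∀ x : M, V x}
    {σ : ∀ a : TotalSpace F V, V a.proj} (hX : SmoothField X) (hη : SmoothSection B F η)
    (hσ : SmoothAlong B F σ) :
    mlieBracket (𝓘(ℝ, B).prod 𝓘(ℝ, F)) (ξ.hlift X + vliftSec B (basic F η)) (vliftSec B σ) =
      vliftSec B (fun e => ξ.covDeriv σ e ((ξ.hlift X + vliftSec B (basic F η)) e)) := by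
  funext a
  have ha : a.proj ∈ coordDom B F V a.proj := mem_coordDom a.proj
  have hY : SmoothFieldE (ξ.hlift X + vliftSec B (basic F η)) :=
    (ξ.smoothFieldE_hlift hX).add (smoothFieldE_vliftSec_iff.2 hη.basic)
  set Y := ξ.hlift X + vliftSec B (basic F η)
  have hproj : dproj B a (Y a) = X a.proj := by
    refine (map_add (dproj B a) _ _).trans ?_
    rw [hlift, ξ.dproj_lift, vliftSec, dproj_vlift, add_zero]
  have hder : HasDerivAt (fun s : ℝ => dcoord B a.proj
      (⟨a.proj, a.2 + s • σ a⟩ : TotalSpace F V) (Y ⟨a.proj, a.2 + s • σ a⟩))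
      (ξ.liftDeriv a.2 (σ a) (X a.proj)) 0 := by
    -- Along the fibre, `η^V` contributes a constant; here it matters that `η` is basic.
    refine ((ξ.hasDerivAt_lift a.2 (σ a) (X a.proj)).add_const
      ((0 : B), fibreCoord F a.proj (η a.proj))).congr_of_eventuallyEq
      (Filter.Eventually.of_forall fun s => ?_)
    have hs : (⟨a.proj, a.2 + s • σ a⟩ : TotalSpace F V).proj ∈ coordDom B F V a.proj := ha
    refine (map_add (dcoord B a.proj _) _ _).trans ?_
    rw [vliftSec, dcoord_vlift hs]
    rfl
  refine dcoord_injective ha ?_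
  rw [dcoord_mlieBracket, fderiv_chartRep_vliftSec hσ, vliftSec, vliftSec,
    fderiv_chartRep_vertical hY a (σ a) hder, dcoord_vlift ha, ξ.fibreCoord_covDeriv hσ, hproj]
  exact Prod.ext ((congrArg (fun p : B => 0 - p) (ξ.liftDeriv_fst _ _ _)).trans (sub_zero 0)) rfl

/-- Both covariant derivatives are plain fibre derivatives here, so any sections along `π` are
allowed. -/
theorem mlieBracket_vliftSec_vliftSec {ρ σ : ∀ a : TotalSpace F V, V a.proj}
    (hρ : SmoothAlong B F ρ) (hσ : SmoothAlong B F σ) (a : TotalSpace F V) :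
    mlieBracket (𝓘(ℝ, B).prod 𝓘(ℝ, F)) (vliftSec B ρ) (vliftSec B σ) a =
      vlift B a (ξ.covDeriv σ a (vliftSec B ρ a) - ξ.covDeriv ρ a (vliftSec B σ a)) := by
  have ha : a.proj ∈ coordDom B F V a.proj := mem_coordDom a.proj
  refine dcoord_injective ha ?_
  rw [dcoord_mlieBracket, fderiv_chartRep_vliftSec hσ, fderiv_chartRep_vliftSec hρ,
    dcoord_vlift ha, fibreCoord_sub (mem_coordDom (B := B) a.proj), ξ.fibreCoord_covDeriv hσ,
    ξ.fibreCoord_covDeriv hρ, vliftSec, vliftSec, dproj_vlift, dproj_vlift, liftDeriv_zero_right,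
    liftDeriv_zero_right]
  refine Prod.ext (sub_zero 0) ?_
  exact congrArg₂ (fun p q : F => p - q) (sub_zero _).symm (sub_zero _).symm

theorem smoothFieldE_mlieBracket {Y W : ∀ a : TotalSpace F V, TE B F a} (hY : SmoothFieldE Y)
    (hW : SmoothFieldE W) : SmoothFieldE (mlieBracket (𝓘(ℝ, B).prod 𝓘(ℝ, F)) Y W) := by
  intro a
  have : IsManifold (𝓘(ℝ, B).prod 𝓘(ℝ, F)) (minSmoothness ℝ 2) (TotalSpace F V) := by
    rw [minSmoothness_of_isRCLikeNormedField]; infer_instance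
  -- The manifold must be one class smoother than the fields; `∞ + 1` is `∞` by definition.
  have : IsManifold (𝓘(ℝ, B).prod 𝓘(ℝ, F)) (((⊤ : ℕ∞) : WithTop ℕ∞) + 1) (TotalSpace F V) :=
    inferInstanceAs (IsManifold (𝓘(ℝ, B).prod 𝓘(ℝ, F)) ∞ (TotalSpace F V))
  exact ContMDiffAt.mlieBracket_vectorField (m := ⊤) (n := ⊤) (hY a) (hW a) (by simp)

theorem smoothField_mlieBracket {X Y : ∀ x : M, TangentSpace 𝓘(ℝ, B) x} (hX : SmoothField X)
    (hY : SmoothField Y) : SmoothField (mlieBracket 𝓘(ℝ, B) X Y) := by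
  intro x
  have : IsManifold 𝓘(ℝ, B) (minSmoothness ℝ 2) M := by
    rw [minSmoothness_of_isRCLikeNormedField]; infer_instance
  have : IsManifold 𝓘(ℝ, B) (((⊤ : ℕ∞) : WithTop ℕ∞) + 1) M :=
    inferInstanceAs (IsManifold 𝓘(ℝ, B) ∞ M)
  exact ContMDiffAt.mlieBracket_vectorField (m := ⊤) (n := ⊤) (hX x) (hY x) (by simp)

/-- The vertical lift of `D_Y σ` is a bracket of smooth fields. -/
theorem smoothAlong_covDeriv {X : ∀ x : M, TangentSpace 𝓘(ℝ, B) x} {η : ∀ x : M, V x}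
    {σ : ∀ a : TotalSpace F V, V a.proj} (hX : SmoothField X) (hη : SmoothSection B F η)
    (hσ : SmoothAlong B F σ) :
    SmoothAlong B F (fun e => ξ.covDeriv σ e ((ξ.hlift X + vliftSec B (basic F η)) e)) := by
  rw [← smoothFieldE_vliftSec_iff, ← ξ.mlieBracket_horizontal_vliftSec hX hη hσ]
  exact smoothFieldE_mlieBracket
    ((ξ.smoothFieldE_hlift hX).add (smoothFieldE_vliftSec_iff.2 hη.basic))
    (smoothFieldE_vliftSec_iff.2 hσ)

theorem vliftSec_zero : vliftSec B (basic F (fun x : M => (0 : V x))) = 0 :=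
  funext fun a => vlift_zero a

theorem smoothSection_zero : SmoothSection B F (fun x : M => (0 : V x)) :=
  contMDiff_zeroSection ℝ V

theorem hlift_add_zero (X : ∀ x : M, TangentSpace 𝓘(ℝ, B) x) :
    ξ.hlift X + vliftSec B (basic F (fun x : M => (0 : V x))) = ξ.hlift X := by
  rw [vliftSec_zero, add_zero]

theorem mlieBracket_hlift_vliftSec {X : ∀ x : M, TangentSpace 𝓘(ℝ, B) x}
    {σ : ∀ a : TotalSpace F V, V a.proj} (hX : SmoothField X) (hσ : SmoothAlong B F σ) :
    mlieBracket (𝓘(ℝ, B).prod 𝓘(ℝ, F)) (ξ.hlift X) (vliftSec B σ) =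
      vliftSec B (fun e => ξ.covDeriv σ e (ξ.hlift X e)) := by
  simpa only [hlift_add_zero] using ξ.mlieBracket_horizontal_vliftSec hX smoothSection_zero hσ

theorem smoothAlong_covDeriv_hlift {X : ∀ x : M, TangentSpace 𝓘(ℝ, B) x}
    {σ : ∀ a : TotalSpace F V, V a.proj} (hX : SmoothField X) (hσ : SmoothAlong B F σ) :
    SmoothAlong B F (fun e => ξ.covDeriv σ e (ξ.hlift X e)) := by
  simpa only [hlift_add_zero] using ξ.smoothAlong_covDeriv hX smoothSection_zero hσ

theorem dproj_hlift (X : ∀ x : M, TangentSpace 𝓘(ℝ, B) x) (a : TotalSpace F V) :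
    dproj B a (ξ.hlift X a) = X a.proj :=
  ξ.dproj_lift a (X a.proj)

/-- `[X^H, Y^H]` projects to `[X, Y]`, so `[X, Y]^H` is its horizontal part and `R` lifts to the
remainder. -/
theorem vliftSec_R {X Y : ∀ x : M, TangentSpace 𝓘(ℝ, B) x} (hX : SmoothField X)
    (hY : SmoothField Y) :
    vliftSec B (ξ.R X Y) = mlieBracket (𝓘(ℝ, B).prod 𝓘(ℝ, F)) (ξ.hlift X) (ξ.hlift Y) -
      ξ.hlift (mlieBracket 𝓘(ℝ, B) X Y) := by
  funext a
  have h := dproj_mlieBracket (ξ.smoothFieldE_hlift hX) (ξ.smoothFieldE_hlift hY) hX hY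
    (ξ.dproj_hlift X) (ξ.dproj_hlift Y) a
  rw [vliftSec, R, connector, vlift_vproj, h]
  · rfl
  · rw [map_sub, ξ.dproj_lift, sub_self]

theorem smoothAlong_R {X Y : ∀ x : M, TangentSpace 𝓘(ℝ, B) x} (hX : SmoothField X)
    (hY : SmoothField Y) : SmoothAlong B F (ξ.R X Y) := by
  rw [← smoothFieldE_vliftSec_iff, ξ.vliftSec_R hX hY]
  exact (smoothFieldE_mlieBracket (ξ.smoothFieldE_hlift hX) (ξ.smoothFieldE_hlift hY)).sub
    (ξ.smoothFieldE_hlift (smoothField_mlieBracket hX hY))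

/-- The bracket of two `Hor`-basic vector fields. -/
theorem mlieBracket_horBasic {X₁ X₂ : ∀ x : M, TangentSpace 𝓘(ℝ, B) x} {η₁ η₂ : ∀ x : M, V x}
    (hX₁ : SmoothField X₁) (hX₂ : SmoothField X₂) (hη₁ : SmoothSection B F η₁)
    (hη₂ : SmoothSection B F η₂) :
    mlieBracket (𝓘(ℝ, B).prod 𝓘(ℝ, F)) (ξ.hlift X₁ + vliftSec B (basic F η₁))
        (ξ.hlift X₂ + vliftSec B (basic F η₂)) =
      ξ.hlift (mlieBracket 𝓘(ℝ, B) X₁ X₂) +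
        vliftSec B (fun e => ξ.R X₁ X₂ e + ξ.covDeriv (basic F η₂) e (ξ.hlift X₁ e) -
          ξ.covDeriv (basic F η₁) e (ξ.hlift X₂ e)) := by
  funext a
  have hH₁ := (ξ.smoothFieldE_hlift hX₁).mdifferentiableAt a
  have hH₂ := (ξ.smoothFieldE_hlift hX₂).mdifferentiableAt a
  have hV₁ := (smoothFieldE_vliftSec_iff.2 hη₁.basic).mdifferentiableAt a
  have hV₂ := (smoothFieldE_vliftSec_iff.2 hη₂.basic).mdifferentiableAt a
  have h1 : ξ.covDeriv (basic F η₂) a ((ξ.hlift X₁ + vliftSec B (basic F η₁)) a) =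
      ξ.covDeriv (basic F η₂) a (ξ.hlift X₁ a) := by
    refine (ξ.covDeriv_add_vlift hη₂.basic a (ξ.hlift X₁ a) (basic F η₁ a)).trans ?_
    rw [ξ.covDeriv_basic_vlift hη₂, add_zero]
  have h2 := congrFun (ξ.vliftSec_R hX₁ hX₂) a
  -- Splitting the second field first keeps `[Y₁, η₂^V]` whole, so that it equals the lift of
  -- `D_{Y₁} η₂`, reduced by `h1` to `D_{X₁^H} η₂`.
  rw [mlieBracket_add_right hH₂ hV₂, ξ.mlieBracket_horizontal_vliftSec hX₁ hη₁ hη₂.basic,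
    mlieBracket_add_left hH₁ hV₁, mlieBracket_swap_apply (V := vliftSec B (basic F η₁)),
    ξ.mlieBracket_hlift_vliftSec hX₂ hη₁.basic]
  simp only [vliftSec, Pi.add_apply, Pi.sub_apply] at h1 h2 ⊢
  rw [h1, vlift_sub, vlift_add, h2]
  abel

/-- The Jacobi identity for `Y₁, Y₂, σ^V`, with every bracket expressed through `D`. -/
theorem curv_horBasic {X₁ X₂ : ∀ x : M, TangentSpace 𝓘(ℝ, B) x} {η₁ η₂ : ∀ x : M, V x}
    {σ : ∀ a : TotalSpace F V, V a.proj}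
    (hX₁ : SmoothField X₁) (hX₂ : SmoothField X₂) (hη₁ : SmoothSection B F η₁)
    (hη₂ : SmoothSection B F η₂) (hσ : SmoothAlong B F σ) (a : TotalSpace F V) :
    ξ.curv (ξ.hlift X₁ + vliftSec B (basic F η₁)) (ξ.hlift X₂ + vliftSec B (basic F η₂)) σ a =
      -ξ.covDeriv (fun e => ξ.R X₁ X₂ e + ξ.covDeriv (basic F η₂) e (ξ.hlift X₁ e) -
        ξ.covDeriv (basic F η₁) e (ξ.hlift X₂ e)) a (vliftSec B σ a) := by
  set ρ : ∀ e : TotalSpace F V, V e.proj := fun e => ξ.R X₁ X₂ e +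
    ξ.covDeriv (basic F η₂) e (ξ.hlift X₁ e) - ξ.covDeriv (basic F η₁) e (ξ.hlift X₂ e)
  have hρ : SmoothAlong B F ρ :=
    ((ξ.smoothAlong_R hX₁ hX₂).add (ξ.smoothAlong_covDeriv_hlift hX₁ hη₂.basic)).sub
      (ξ.smoothAlong_covDeriv_hlift hX₂ hη₁.basic)
  have hY₁ : SmoothFieldE (ξ.hlift X₁ + vliftSec B (basic F η₁)) :=
    (ξ.smoothFieldE_hlift hX₁).add (smoothFieldE_vliftSec_iff.2 hη₁.basic)
  have hY₂ : SmoothFieldE (ξ.hlift X₂ + vliftSec B (basic F η₂)) :=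
    (ξ.smoothFieldE_hlift hX₂).add (smoothFieldE_vliftSec_iff.2 hη₂.basic)
  have hZ := smoothField_mlieBracket hX₁ hX₂
  have hσV := smoothFieldE_vliftSec_iff.2 hσ
  have hle : minSmoothness ℝ 2 ≤ (∞ : WithTop ℕ∞) := by
    rw [minSmoothness_of_isRCLikeNormedField]; exact ENat.LEInfty.out
  have hman : IsManifold (𝓘(ℝ, B).prod 𝓘(ℝ, F)) (minSmoothness ℝ 3) (TotalSpace F V) := by
    simp only [minSmoothness_of_isRCLikeNormedField]; infer_instance
  have jacobi := leibniz_identity_mlieBracket_apply (x := a)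
    ((hY₁ a).of_le hle) ((hY₂ a).of_le hle) ((hσV a).of_le hle)
  have hbr := ξ.mlieBracket_horBasic hX₁ hX₂ hη₁ hη₂
  have e1 := congrFun (ξ.mlieBracket_horizontal_vliftSec hX₁ hη₁ (ξ.smoothAlong_covDeriv hX₂ hη₂ hσ)) a
  have e2 := congrFun (ξ.mlieBracket_horizontal_vliftSec hX₂ hη₂ (ξ.smoothAlong_covDeriv hX₁ hη₁ hσ)) a
  -- The inner lifts are turned back into brackets, so that `e1` and `e2` evaluate the nested
  -- brackets of the Jacobi identity.
  rw [← ξ.mlieBracket_horizontal_vliftSec hX₂ hη₂ hσ] at e1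
  rw [← ξ.mlieBracket_horizontal_vliftSec hX₁ hη₁ hσ] at e2
  -- Since `ρ` need not be basic, the key identity is unavailable for `ρ^V`; the bracket of two
  -- vertical lifts supplies the extra `-D_{σ^V} ρ`, the source of the curvature.
  have e3 : mlieBracket (𝓘(ℝ, B).prod 𝓘(ℝ, F))
      (ξ.hlift (mlieBracket 𝓘(ℝ, B) X₁ X₂) + vliftSec B ρ) (vliftSec B σ) a =
      vlift B a (ξ.covDeriv σ a (ξ.hlift (mlieBracket 𝓘(ℝ, B) X₁ X₂) a)) +
      vlift B a (ξ.covDeriv σ a (vliftSec B ρ a) - ξ.covDeriv ρ a (vliftSec B σ a)) := by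
    rw [mlieBracket_add_left ((ξ.smoothFieldE_hlift hZ).mdifferentiableAt a)
      ((smoothFieldE_vliftSec_iff.2 hρ).mdifferentiableAt a),
      ξ.mlieBracket_hlift_vliftSec hZ hσ, ξ.mlieBracket_vliftSec_vliftSec hρ hσ]
    rfl
  have e4 : ξ.covDeriv σ a ((ξ.hlift (mlieBracket 𝓘(ℝ, B) X₁ X₂) + vliftSec B ρ) a) =
      ξ.covDeriv σ a (ξ.hlift (mlieBracket 𝓘(ℝ, B) X₁ X₂) a) +
      ξ.covDeriv σ a (vliftSec B ρ a) := ξ.covDeriv_add_vlift hσ a _ _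
  refine vlift_injective (B := B) a ?_
  rw [curv, vlift_sub, vlift_sub, vlift_neg]
  rw [hbr] at jacobi ⊢
  rw [e1, e2, e3] at jacobi
  rw [e4]
  simp only [vliftSec] at jacobi ⊢
  rw [jacobi, vlift_add, vlift_sub]
  abel

/-- Any vector is the horizontal lift of its projection plus the vertical lift of its `κ`; the two
conditions say that these parts come from `M`. -/
theorem isHorBasic_iff (Y : ∀ a : TotalSpace F V, TE B F a) :
    ξ.IsHorBasic Y ↔ ∃ (X : ∀ x : M, TangentSpace 𝓘(ℝ, B) x) (η : ∀ x : M, V x),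
      SmoothField X ∧ SmoothSection B F η ∧ Y = ξ.hlift X + vliftSec B (basic F η) := by
  constructor
  · rintro ⟨-, ⟨X, hX, hXY⟩, η, hη, hηY⟩
    refine ⟨X, η, hX, hη, funext fun a => ?_⟩
    have hv : dproj B a (Y a - ξ.lift a (dproj B a (Y a))) = 0 := by
      rw [map_sub, ξ.dproj_lift, sub_self]
    have h := vlift_vproj hv
    change vlift B a (ξ.connector a (Y a)) = _ at h
    rw [hηY, hXY] at h
    change Y a = ξ.lift a (X a.proj) + vlift B a (η a.proj)
    rw [h]
    abel
  · rintro ⟨X, η, hX, hη, rfl⟩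
    have hp : ∀ a, dproj B a ((ξ.hlift X + vliftSec B (basic F η)) a) = X a.proj := by
      intro a
      refine (map_add (dproj B a) _ _).trans ?_
      rw [dproj_hlift, vliftSec, dproj_vlift, add_zero]
    refine ⟨(ξ.smoothFieldE_hlift hX).add (smoothFieldE_vliftSec_iff.2 hη.basic),
      ⟨X, hX, hp⟩, η, hη, fun a => ?_⟩
    rw [connector, hp]
    have : (ξ.hlift X + vliftSec B (basic F η)) a - ξ.lift a (X a.proj) =
      vlift B a (η a.proj) := add_sub_cancel_left _ _
    rw [this, vproj_vlift]

/-! ### Zero fields and zero directions -/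

theorem smoothField_zero : SmoothField (0 : ∀ x : M, TangentSpace 𝓘(ℝ, B) x) :=
  contMDiff_zeroSection ℝ (TangentSpace 𝓘(ℝ, B) : M → Type _)

theorem hlift_zero : ξ.hlift (0 : ∀ x : M, TangentSpace 𝓘(ℝ, B) x) = 0 :=
  funext fun a => map_zero (ξ.lift a)

theorem R_zero_left (X : ∀ x : M, TangentSpace 𝓘(ℝ, B) x) (a : TotalSpace F V) :
    ξ.R 0 X a = 0 := by
  have h : mlieBracket (𝓘(ℝ, B).prod 𝓘(ℝ, F)) (0 : ∀ a : TotalSpace F V, TE B F a) (ξ.hlift X) a =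
    0 := congrFun mlieBracket_zero_left a
  rw [R, hlift_zero, h, connector, map_zero, map_zero, sub_zero, vproj_zero]

theorem covDeriv_apply_zero {σ : ∀ a : TotalSpace F V, V a.proj} (hσ : SmoothAlong B F σ)
    (a : TotalSpace F V) : ξ.covDeriv σ a 0 = 0 := by
  -- The zero vector is the vertical lift of zero, so additivity gives `D = D + D`.
  have := ξ.covDeriv_add_vlift hσ a 0 0
  rw [vlift_zero, add_zero] at this
  simpa using this

end Complete

end EhresmannConnection

end Curvature

end NonlinearConnection

end

/-! ### The theorem and its three components -/

open NonlinearConnection in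
theorem theorem6p7
    {B : Type*} [NormedAddCommGroup B] [NormedSpace ℝ B] [CompleteSpace B]
    {M : Type*} [TopologicalSpace M] [ChartedSpace B M] [IsManifold 𝓘(ℝ, B) ∞ M]
    {F : Type*} [NormedAddCommGroup F] [NormedSpace ℝ F] [CompleteSpace F]
    {V : M → Type*} [TopologicalSpace (Bundle.TotalSpace F V)]
    [∀ x, AddCommGroup (V x)] [∀ x, Module ℝ (V x)] [∀ x, TopologicalSpace (V x)]
    [FiberBundle F V] [VectorBundle ℝ F V] [ContMDiffVectorBundle ∞ F V 𝓘(ℝ, B)]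
    (ξ : EhresmannConnection B F V) :
    -- the Hor-basic vector fields are the fields `X^H + η^V`
    (∀ Y : ∀ a : Bundle.TotalSpace F V, TE B F a,
      ξ.IsHorBasic Y ↔ ∃ (X : ∀ x : M, TangentSpace 𝓘(ℝ, B) x) (η : ∀ x : M, V x),
        SmoothField X ∧ SmoothSection B F η ∧ Y = ξ.hlift X + vliftSec B (basic F η)) ∧
    -- the curvature on Hor-basic vector fields
    (∀ (X₁ X₂ : ∀ x : M, TangentSpace 𝓘(ℝ, B) x) (η₁ η₂ : ∀ x : M, V x)
      (σ : ∀ a : Bundle.TotalSpace F V, V a.proj),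
      SmoothField X₁ → SmoothField X₂ → SmoothSection B F η₁ → SmoothSection B F η₂ →
      SmoothAlong B F σ → ∀ a : Bundle.TotalSpace F V,
      ξ.curv (ξ.hlift X₁ + vliftSec B (basic F η₁)) (ξ.hlift X₂ + vliftSec B (basic F η₂)) σ a =
        -ξ.covDeriv (fun e => ξ.R X₁ X₂ e + ξ.covDeriv (basic F η₂) e (ξ.hlift X₁ e) -
          ξ.covDeriv (basic F η₁) e (ξ.hlift X₂ e)) a (vliftSec B σ a)) ∧
    -- the component `Curv(X^H, Y^H)`
    (∀ (X Y : ∀ x : M, TangentSpace 𝓘(ℝ, B) x) (σ : ∀ a : Bundle.TotalSpace F V, V a.proj),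
      SmoothField X → SmoothField Y → SmoothAlong B F σ → ∀ a : Bundle.TotalSpace F V,
      ξ.curv (ξ.hlift X) (ξ.hlift Y) σ a = -ξ.covDeriv (ξ.R X Y) a (vliftSec B σ a)) ∧
    -- the component `Curv(η^V, Y^H)`
    (∀ (η : ∀ x : M, V x) (Y : ∀ x : M, TangentSpace 𝓘(ℝ, B) x)
      (σ : ∀ a : Bundle.TotalSpace F V, V a.proj),
      SmoothSection B F η → SmoothField Y → SmoothAlong B F σ → ∀ a : Bundle.TotalSpace F V,
      ξ.curv (vliftSec B (basic F η)) (ξ.hlift Y) σ a =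
        ξ.covDeriv (fun e => ξ.covDeriv (basic F η) e (ξ.hlift Y e)) a (vliftSec B σ a)) ∧
    -- the component `Curv(η^V, ζ^V)`
    (∀ (η ζ : ∀ x : M, V x) (σ : ∀ a : Bundle.TotalSpace F V, V a.proj),
      SmoothSection B F η → SmoothSection B F ζ → SmoothAlong B F σ →
      ∀ a : Bundle.TotalSpace F V,
      ξ.curv (vliftSec B (basic F η)) (vliftSec B (basic F ζ)) σ a = 0) := by
  have hbasic : ∀ e w, ξ.covDeriv (basic F (fun x : M => (0 : V x))) e w = 0 := ξ.covDeriv_zero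
  have hzero : ∀ (η : ∀ x : M, V x) (e : Bundle.TotalSpace F V), SmoothSection B F η →
      ξ.covDeriv (basic F η) e (ξ.hlift 0 e) = 0 := by
    intro η e hη
    rw [ξ.hlift_zero]
    exact ξ.covDeriv_apply_zero hη.basic e
  have hvert : ∀ η : ∀ x : M, V x,
      ξ.hlift 0 + vliftSec B (basic F η) = vliftSec B (basic F η) := by
    intro η
    rw [ξ.hlift_zero, zero_add]
  refine ⟨ξ.isHorBasic_iff, ?_, ?_, ?_, ?_⟩
  · intro X₁ X₂ η₁ η₂ σ hX₁ hX₂ hη₁ hη₂ hσ a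
    exact ξ.curv_horBasic hX₁ hX₂ hη₁ hη₂ hσ a
  · intro X Y σ hX hY hσ a
    have h := ξ.curv_horBasic hX hY EhresmannConnection.smoothSection_zero
      EhresmannConnection.smoothSection_zero hσ a
    simp only [ξ.hlift_add_zero, hbasic, add_zero, sub_zero] at h
    exact h
  · intro η Y σ hη hY hσ a
    have h := ξ.curv_horBasic EhresmannConnection.smoothField_zero hY hη
      EhresmannConnection.smoothSection_zero hσ a
    rw [hvert, ξ.hlift_add_zero] at h
    -- With `X₁ = 0` and `η₂ = 0` only `ρ = -D_{Y^H} η` is left, and its sign cancels the outer one.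
    simp only [hbasic, ξ.R_zero_left, add_zero, zero_sub] at h
    rw [h, vliftSec, ξ.covDeriv_neg (ξ.smoothAlong_covDeriv_hlift hY hη.basic), neg_neg]
  · intro η ζ σ hη hζ hσ a
    have h := ξ.curv_horBasic EhresmannConnection.smoothField_zero
      EhresmannConnection.smoothField_zero hη hζ hσ a
    rw [hvert, hvert] at h
    -- With `X₁ = X₂ = 0` every term of `ρ` vanishes.
    simp only [hzero _ _ hη, hzero _ _ hζ, ξ.R_zero_left, add_zero, sub_zero] at h
    rw [h, ξ.covDeriv_zero, neg_zero]
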